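/- For $C>0$ and $k<0$ let $V_P(x)=\dfrac{e^{-C/|x|}}{|x|}$ and $V_P^k(x)=V_P(x)\,e^{k|x|}$ for $x\in\mathbb R^3\setminus\{0\}$. Fourier transforms use the normalization $\widehat f(\xi)=\int_{\mathbb R^3}f(x)e^{-2\pi i x\cdot\xi}\,dx$, extended to tempered distributions by $\langle\widehat u,\varphi\rangle=\langle u,\widehat\varphi\rangle$; tempered distributions converge when they converge on each Schwartz function, and a function $f$ is identified with the tempered distribution $\varphi\mapsto\int f\varphi$ whenever this integral converges absolutely for every Schwartz function $\varphi$ and depends continuously on $\varphi$. Square roots and powers of complex numbers are principal values, $I_\nu(w)=\sum_{m\ge 0}\dfrac{1}{m!\,\Gamma(\nu+m+1)}\left(\dfrac w2\right)^{\nu+2m}$ (with $1/\Gamma=0$ at the poles of $\Gamma$), and $$K_1(w)=\lim_{\alpha\to1}\frac{\pi}{2}\,\frac{I_{-\alpha}(w)-I_\alpha(w)}{\sin(\alpha\pi)}\qquad(w\neq0)$$ with real $\alpha\ne1$, where the limit exists for every $w\ne 0$. For $k\le 0$ and $\xi\ne0$ put $$F_{C,k}(\xi)=\frac{2}{|\xi|}\,\mathrm{Im}\left(\frac{2K_1\!\left(2\sqrt{-C(k+2\pi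 i|\xi|)}\right)}{\sqrt{-\dfrac{k+2\pi i|\xi|}{C}}}\right).$$ Then the following hold. 1. For every $C>0$, $V_P\notin L^1(\mathbb R^3)$, whereas $V_P^k\in L^1(\mathbb R^3)$ for every $k<0$. For $\xi\neq 0$ and $k<0$ the classical Fourier transform is $\widehat{V_P^k}(\xi)=F_{C,k}(\xi)$, and $\lim_{k\to0^-}\widehat{V_P^k}(\xi)=F_{C,0}(\xi)$. 2. For every $C>0$ and $k<0$, the functions $V_P$, $V_P^k$ and $1/|x|$ define tempered distributions. As $k\to0^-$, $V_P^k\to V_P$ and $\widehat{V_P^k}\to\widehat{V_P}$ as tempered distributions. The distributional Fourier transform of $V_P^k$ is the function $F_{C,k}$, and that of $V_P$ is the function $F_{C,0}$: $$\widehat{V_P}(\xi)=\frac{2}{|\xi|}\,\mathrm{Im}\left(\frac{2K_1\!\left(2\sqrt{-2\pi iC|\xi|}\right)}{\sqrt{\dfrac{-2\pi i|\xi|}{C}}}\right).$$ 3. For every $\xi\ne0$, $$\lim_{C\to0^+}F_{C,0}(\xi)=\frac{2}{|\xi|}\,\mathrm{Im}\frac{i}{2\pi|\xi|}=\frac{1}{\pi|\xi|^2}.$$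 Moreover, as $C\to0^+$, $V_P\to 1/|x|$ and $\widehat{V_P}\to\widehat{1/|x|}$ as tempered distributions, and the Fourier transform of the Coulomb potential $1/|x|$ is the function $\dfrac{1}{\pi|\xi|^2}$. -/

import Mathlib

open MeasureTheory Filter
open scoped Topology FourierTransform SchwartzMap

noncomputable section

/-- Three-dimensional Euclidean space `ℝ³`. -/
abbrev Space3 : Type := EuclideanSpace ℝ (Fin 3)

/-- The softened Coulomb potential `V_P(x) = e^{-C/|x|} / |x|`. At the origin the Lean expression
has the value `0`, which is the continuous extension for `C > 0`. -/
def softPotential (C : ℝ) (x : Space3) : ℝ :=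
  Real.exp (-C / ‖x‖) / ‖x‖

/-- The damped potential `V_P^k(x) = V_P(x) e^{k|x|}`, used for `k < 0`. -/
def dampedPotential (C k : ℝ) (x : Space3) : ℝ :=
  softPotential C x * Real.exp (k * ‖x‖)

/-- The Coulomb potential `1/|x|`. -/
def coulombPotential (x : Space3) : ℝ := 1 / ‖x‖

/-- The modified Bessel function of the first kind (principal branch),
`I_ν(z) = ∑_m (z/2)^{ν+2m} / (m! Γ(ν+m+1))`. For `ν` a negative integer the terms in which `Γ` has
a pole vanish, as they should, because Mathlib's `Γ` is `0` there. -/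
def besselI (ν z : ℂ) : ℂ :=
  ∑' m : ℕ, (z / 2) ^ (ν + 2 * (m : ℂ)) / ((m.factorial : ℂ) * Complex.Gamma (ν + m + 1))

/-- The quotient `(π/2) (I_{-α}(z) - I_α(z)) / sin(απ)`, which is `K_α(z)` for `α` not an
integer. -/
def besselKQuotient (z : ℂ) (α : ℝ) : ℂ :=
  (Real.pi : ℂ) / 2 * ((besselI (-(α : ℂ)) z - besselI (α : ℂ) z) / (Real.sin (α * Real.pi) : ℂ))

/-- The modified Bessel function of the second kind of order one,
`K_1(z) = lim_{α → 1} (π/2) (I_{-α}(z) - I_α(z)) / sin(απ)`. -/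
def besselK1 (z : ℂ) : ℂ :=
  limUnder (𝓝[≠] (1 : ℝ)) (besselKQuotient z)

/-- The closed form
`(2/|ξ|) Im [ 2 K_1(2 √(-C(k + 2πi|ξ|))) / √(-(k + 2πi|ξ|)/C) ]`, with principal square roots. -/
def closedForm (C k : ℝ) (ξ : Space3) : ℝ :=
  2 / ‖ξ‖ *
    (2 * besselK1 (2 * Complex.sqrt (-(C : ℂ) * ((k : ℂ) + 2 * Real.pi * Complex.I * ‖ξ‖))) /
      Complex.sqrt (-((k : ℂ) + 2 * Real.pi * Complex.I * ‖ξ‖) / (C : ℂ))).im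

/-- The tempered distribution `T` is (integration against) the real function `f`: for every
Schwartz function `φ` the product `φ f` is integrable and `T φ = ∫ φ f`. -/
def IsGivenBy (T : 𝓢'(Space3, ℂ)) (f : Space3 → ℝ) : Prop :=
  ∀ φ : 𝓢(Space3, ℂ),
    Integrable (fun x => φ x * (f x : ℂ)) ∧ T φ = ∫ x, φ x * (f x : ℂ)

end

/-! ### Bessel functions as functions of the order -/

/-! On ℝ³ the Fourier integral of g(|x|)/|x| collapses to the sine transform (2/|ξ|) ∫₀^∞ g(s)
sin(2π|ξ|s) ds (`fourier_radial`). For V_P^k this is 2/|ξ| times the imaginary part of the Laplace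
transform of e^{-C/r} at a = -(k + 2πi|ξ|), where Re a = -k > 0. A substitution and an integration
by parts turn that Laplace transform into J(Ca)/a with J(w) = ∫₀^∞ e^{-t-w/t} dt
(`integral_exp_neg_div_mul_exp_neg`).

It remains to see that J(w) = 2√w K_1(2√w) (`two_mul_sqrt_mul_besselK1`). Since K_1 is a limit in
the order, orders 0 < a < 1 come first. The integral of t^{a-1} e^{-t-w/t} is cut at t = 1, the part
over (0,1) is inverted by t ↦ 1/t, and the factors e^{-w/t} and e^{-1/t} are expanded. Every
resulting incomplete Gamma integral is a complete Gamma term minus a lower series. The lower series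
add up to one double series taken with both signs, so they cancel, and the reflection formula
identifies the rest with I_{±a}; then a → 1⁻. The argument covers Re w = 0, w ≠ 0, so the undamped
case k = 0 is included.

For the limits, |J| ≤ 1 and J is continuous on Re w ≥ 0 with J(0) = 1. Hence F_{C,k} is bounded by
1/(π|ξ|²) for all C > 0, k ≤ 0 (`abs_closedForm_le`), while 1/|x| dominates all the potentials. Both
majorants are integrable against Schwartz functions, so dominated convergence and the continuity of
the distributional Fourier transform carry the formula from the integrable V_P^k to V_P, and from
there to 1/|x|. -/

lemma exists_norm_inv_Gamma_add_nat_le :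
    ∃ M : ℝ, ∀ ν : ℂ, ‖ν‖ ≤ 2 → ∀ m : ℕ, ‖(Complex.Gamma (ν + m + 1))⁻¹‖ ≤ M := by
  -- The reciprocal 1/Γ is entire. Radius 5 = 2 + 2 + 1 covers ν + m + 1 for m ≤ 2; beyond that the
  -- functional equation divides by a number of modulus at least 1.
  obtain ⟨M, hM⟩ := (isCompact_closedBall (0 : ℂ) 5).exists_bound_of_continuousOn
    Complex.differentiable_one_div_Gamma.continuous.continuousOn
  refine ⟨M, fun ν hν m => ?_⟩
  have small : ∀ m : ℕ, m ≤ 2 → ‖(Complex.Gamma (ν + m + 1))⁻¹‖ ≤ M := by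
    intro m hm
    apply hM
    have h1 : ‖ν + (m : ℂ) + 1‖ ≤ ‖ν‖ + ‖(m : ℂ)‖ + ‖(1 : ℂ)‖ := norm_add₃_le
    have h2 : (m : ℝ) ≤ 2 := by exact_mod_cast hm
    simp only [Complex.norm_natCast, norm_one] at h1
    rw [mem_closedBall_zero_iff]
    linarith
  induction m with
  | zero => exact small 0 (by norm_num)
  | succ m ih =>
    rcases le_or_gt (m + 1) 2 with h | h
    · exact small _ h
    · have h3 : (2 : ℝ) ≤ m := by exact_mod_cast (by omega : 2 ≤ m)
      have hn : 1 ≤ ‖ν + (m : ℂ) + 1‖ := by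
        have h4 := norm_sub_norm_le ((m : ℂ) + 1) (-ν)
        have h5 : ‖(m : ℂ) + 1‖ = m + 1 := by
          exact_mod_cast Complex.norm_natCast (m + 1)
        rw [norm_neg, h5, show (m : ℂ) + 1 - -ν = ν + m + 1 by ring] at h4
        linarith
      have hne : ν + (m : ℂ) + 1 ≠ 0 := norm_pos_iff.1 (by linarith)
      push_cast
      rw [← add_assoc, Complex.Gamma_add_one _ hne, mul_inv, norm_mul, norm_inv]
      calc _ ≤ 1 * ‖(Complex.Gamma (ν + m + 1))⁻¹‖ := by
            gcongr
            exact inv_le_one_of_one_le₀ hn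
        _ ≤ M := by rw [one_mul]; exact ih

lemma cpow_add_two_mul_nat {x : ℂ} (hx : x ≠ 0) (ν : ℂ) (m : ℕ) :
    x ^ (ν + 2 * (m : ℂ)) = x ^ ν * (x ^ 2) ^ m := by
  rw [Complex.cpow_add _ _ hx, ← pow_mul, ← Complex.cpow_natCast x (2 * m)]
  push_cast
  rfl

/-- The majorant does not depend on the order in the disc of radius 2, whose interior contains ±1.
It gives both holomorphy in ν and convergence of the series. -/
lemma exists_summable_bound_besselI_term {z : ℂ} (hz : z ≠ 0) :
    ∃ u : ℕ → ℝ, Summable u ∧ ∀ m : ℕ, ∀ ν : ℂ, ‖ν‖ ≤ 2 →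
      ‖(z / 2) ^ (ν + 2 * (m : ℂ)) / ((m.factorial : ℂ) * Complex.Gamma (ν + m + 1))‖ ≤ u m := by
  obtain ⟨M, hM⟩ := exists_norm_inv_Gamma_add_nat_le
  have hz2 : z / 2 ≠ 0 := div_ne_zero hz two_ne_zero
  refine ⟨fun m => Real.exp (‖Complex.log (z / 2)‖ * 2) * M * ((‖z / 2‖ ^ 2) ^ m / m.factorial),
    (Real.summable_pow_div_factorial _).mul_left _, fun m ν hν => ?_⟩
  have h1 : ‖(z / 2) ^ ν‖ ≤ Real.exp (‖Complex.log (z / 2)‖ * 2) := by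
    rw [Complex.cpow_def_of_ne_zero hz2]
    refine (Complex.norm_exp_le_exp_norm _).trans (Real.exp_le_exp.2 ?_)
    rw [norm_mul]
    gcongr
  rw [cpow_add_two_mul_nat hz2, div_eq_mul_inv, mul_inv, norm_mul, norm_mul, norm_mul, norm_pow,
    norm_pow, norm_inv, Complex.norm_natCast]
  calc _ ≤ Real.exp (‖Complex.log (z / 2)‖ * 2) * (‖z / 2‖ ^ 2) ^ m *
        ((m.factorial : ℝ)⁻¹ * M) := by
        gcongr
        exact hM ν hν m
    _ = _ := by ring

lemma differentiableOn_besselI_order {z : ℂ} (hz : z ≠ 0) :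
    DifferentiableOn ℂ (fun ν => besselI ν z) (Metric.ball 0 2) := by
  obtain ⟨u, hu, hb⟩ := exists_summable_bound_besselI_term hz
  have hz2 : z / 2 ≠ 0 := div_ne_zero hz two_ne_zero
  refine Complex.differentiableOn_tsum_of_summable_norm hu (fun m => ?_) Metric.isOpen_ball
    fun m ν hν => hb m ν (mem_ball_zero_iff.1 hν).le
  refine Differentiable.differentiableOn ?_
  have h1 : Differentiable ℂ fun ν : ℂ => (Complex.Gamma (ν + m + 1))⁻¹ :=
    Complex.differentiable_one_div_Gamma.comp (by fun_prop : Differentiable ℂ fun ν : ℂ => ν + m + 1)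
  have h2 : Differentiable ℂ fun ν : ℂ => (z / 2) ^ (ν + 2 * (m : ℂ)) := by
    intro ν
    exact DifferentiableAt.const_cpow (by fun_prop) (Or.inl hz2)
  simp only [div_eq_mul_inv, mul_inv] at h2 ⊢
  exact h2.mul ((differentiable_const _).mul h1)

lemma besselI_neg_one {z : ℂ} (hz : z ≠ 0) : besselI (-1) z = besselI 1 z := by
  obtain ⟨u, hu, hb⟩ := exists_summable_bound_besselI_term hz
  have hs := Summable.of_norm_bounded hu fun m => hb m (-1) (by norm_num)
  -- The term m = 0 sits at the pole Γ(0), where the default values Γ(0) = 0 and division by 0 make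
  -- it vanish; the other terms match after an index shift.
  rw [besselI, hs.tsum_eq_zero_add, besselI]
  simp only [Nat.cast_zero, neg_add_cancel, add_zero, Complex.Gamma_zero, mul_zero, div_zero,
    zero_add]
  refine tsum_congr fun m => ?_
  have h1 : (-1 : ℂ) + 2 * ((m + 1 : ℕ) : ℂ) = 1 + 2 * m := by push_cast; ring
  have h2 : (-1 : ℂ) + ((m + 1 : ℕ) : ℂ) + 1 = m + 1 := by push_cast; ring
  have h3 : (m : ℂ) + 1 ≠ 0 := Nat.cast_add_one_ne_zero m
  rw [h1, h2, show (1 : ℂ) + m + 1 = m + 1 + 1 by ring, Complex.Gamma_add_one _ h3,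
    Nat.factorial_succ]
  push_cast
  congr 1
  ring

/-- Numerator and denominator both vanish at α = 1, since I_{-1} = I_1 and sin π = 0. The quotient
is therefore a ratio of slopes and tends to the ratio of derivatives; that of the sine is π cos π ≠
0. -/
theorem tendsto_besselKQuotient {z : ℂ} (hz : z ≠ 0) :
    Tendsto (besselKQuotient z) (𝓝[≠] (1 : ℝ)) (𝓝 (besselK1 z)) := by
  have hd := differentiableOn_besselI_order hz
  have key : ∀ ν : ℂ, ‖ν‖ = 1 → DifferentiableAt ℂ (fun ν => besselI ν z) ν := fun ν hν =>
    hd.differentiableAt (Metric.isOpen_ball.mem_nhds (by simp [hν]))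
  have h1 : HasDerivAt (fun α : ℝ => besselI (α : ℂ) z) _ 1 :=
    (key ((1 : ℝ) : ℂ) (by simp)).hasDerivAt.comp_ofReal
  have h2 : HasDerivAt (fun α : ℝ => besselI (-(α : ℂ)) z) _ 1 :=
    (((key (-((1 : ℝ) : ℂ)) (by simp)).comp ((1 : ℝ) : ℂ)
      differentiableAt_id.neg).hasDerivAt).comp_ofReal
  have h3 := h2.sub h1
  have h4 : HasDerivAt (fun α : ℝ => ((Real.sin (α * Real.pi) : ℝ) : ℂ)) _ 1 :=
    (((hasDerivAt_id (1 : ℝ)).mul_const Real.pi).sin).ofReal_comp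
  have h5 := (hasDerivAt_iff_tendsto_slope.1 h3).div (hasDerivAt_iff_tendsto_slope.1 h4) (by simp)
  have h6 := h5.const_mul ((Real.pi : ℂ) / 2)
  refine tendsto_nhds_limUnder ⟨_, h6.congr' ?_⟩
  filter_upwards [self_mem_nhdsWithin] with α hα
  have hα' : (α : ℂ) - 1 ≠ 0 := by
    rw [sub_ne_zero]
    exact_mod_cast hα
  simp only [besselKQuotient, slope_def_module, Pi.sub_apply, Pi.div_apply, Complex.ofReal_one,
    besselI_neg_one hz, sub_self, sub_zero, one_mul, Real.sin_pi, Complex.ofReal_zero,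
    Complex.real_smul, Complex.ofReal_inv, Complex.ofReal_sub]
  rw [mul_div_mul_left _ _ (inv_ne_zero hα')]

/-! ### Incomplete Gamma integrals -/

/-- The integral `∫_1^∞ t^{a-1} e^{-wt} dt`. -/
noncomputable def upperGamma (a : ℝ) (w : ℂ) : ℂ :=
  ∫ t in Set.Ioi (1 : ℝ), ((t ^ (a - 1) : ℝ) : ℂ) * Complex.exp (-(w * t))

/-- The series of the lower incomplete Gamma integral `∫_0^1 t^{a-1} e^{-wt} dt`, which makes sense
for all `a` that are not nonpositive integers. -/
noncomputable def lowerGammaSeries (a : ℝ) (w : ℂ) : ℂ :=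
  ∑' n : ℕ, (-w) ^ n / ((n.factorial : ℂ) * ((a : ℂ) + n))

lemma norm_exp_neg_mul_ofReal (w : ℂ) (t : ℝ) :
    ‖Complex.exp (-(w * t))‖ = Real.exp (-(w.re * t)) := by
  rw [Complex.norm_exp]
  simp

lemma norm_rpow_mul_exp {t : ℝ} (ht : 0 < t) (b : ℝ) (w : ℂ) :
    ‖((t ^ b : ℝ) : ℂ) * Complex.exp (-(w * t))‖ = t ^ b * Real.exp (-(w.re * t)) := by
  rw [norm_mul, norm_exp_neg_mul_ofReal, Complex.norm_real, Real.norm_of_nonneg (by positivity)]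

lemma measurable_rpow_mul_exp (b : ℝ) (w : ℂ) :
    Measurable fun t : ℝ => ((t ^ b : ℝ) : ℂ) * Complex.exp (-(w * t)) := by
  fun_prop

lemma integrableOn_rpow_mul_exp_neg {b r : ℝ} (hb : -1 < b) (hr : 0 < r) :
    IntegrableOn (fun t : ℝ => t ^ b * Real.exp (-(r * t))) (Set.Ioi 0) := by
  have := integrableOn_rpow_mul_exp_neg_mul_rpow hb zero_lt_one hr
  refine this.congr_fun (fun t _ => ?_) measurableSet_Ioi
  simp

lemma integrableOn_Ioi_zero_rpow_mul_exp {b : ℝ} (hb : -1 < b) {w : ℂ} (hw : 0 < w.re) :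
    IntegrableOn (fun t : ℝ => ((t ^ b : ℝ) : ℂ) * Complex.exp (-(w * t))) (Set.Ioi 0) := by
  refine Integrable.mono' (integrableOn_rpow_mul_exp_neg hb hw)
    (measurable_rpow_mul_exp b w).aestronglyMeasurable ?_
  filter_upwards [ae_restrict_mem measurableSet_Ioi] with t ht
  exact (norm_rpow_mul_exp ht b w).le

lemma integrableOn_Ioi_one_rpow_mul_exp (b : ℝ) {w : ℂ} (hw : 0 < w.re) :
    IntegrableOn (fun t : ℝ => ((t ^ b : ℝ) : ℂ) * Complex.exp (-(w * t))) (Set.Ioi 1) := by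
  have h1 : IntegrableOn (fun t : ℝ => t ^ |b| * Real.exp (-(w.re * t))) (Set.Ioi 1) :=
    (integrableOn_rpow_mul_exp_neg (by linarith [abs_nonneg b]) hw).mono_set
      (Set.Ioi_subset_Ioi zero_le_one)
  refine Integrable.mono' h1 (measurable_rpow_mul_exp b w).aestronglyMeasurable ?_
  filter_upwards [ae_restrict_mem measurableSet_Ioi] with t ht
  rw [norm_rpow_mul_exp (zero_lt_one.trans ht)]
  gcongr
  · exact le_of_lt ht
  · exact le_abs_self b

lemma differentiableOn_integral_rpow_mul_exp {a : ℝ} (ha : 0 < a) :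
    DifferentiableOn ℂ
      (fun w : ℂ => ∫ t in Set.Ioi (0 : ℝ), ((t ^ (a - 1) : ℝ) : ℂ) * Complex.exp (-(w * t)))
      {w | 0 < w.re} := by
  intro w hw
  have hw' : 0 < w.re := hw
  refine DifferentiableAt.differentiableWithinAt ?_
  have hs : {v : ℂ | w.re / 2 < v.re} ∈ 𝓝 w :=
    (isOpen_lt continuous_const Complex.continuous_re).mem_nhds (by simp; linarith)
  refine (hasDerivAt_integral_of_dominated_loc_of_deriv_le hs
    (F' := fun v (t : ℝ) => ((t ^ (a - 1) : ℝ) : ℂ) * (Complex.exp (-(v * t)) * (-t)))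
    (bound := fun t => t ^ a * Real.exp (-(w.re / 2 * t)))
    (Eventually.of_forall fun v => (measurable_rpow_mul_exp _ v).aestronglyMeasurable)
    (integrableOn_Ioi_zero_rpow_mul_exp (by linarith) hw') ?_ ?_
    (integrableOn_rpow_mul_exp_neg (by linarith) (by linarith)) ?_).2.differentiableAt
  · exact Measurable.aestronglyMeasurable (by fun_prop)
  · filter_upwards [ae_restrict_mem measurableSet_Ioi] with t ht v hv
    have ht' : (0 : ℝ) < t := ht
    have hv' : w.re / 2 < v.re := hv
    rw [← mul_assoc, norm_mul, norm_rpow_mul_exp ht', norm_neg, Complex.norm_real,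
      Real.norm_of_nonneg ht'.le, Real.rpow_sub_one ht'.ne',
      show t ^ a / t * Real.exp (-(v.re * t)) * t = t ^ a * Real.exp (-(v.re * t)) by field_simp]
    gcongr
  · refine Eventually.of_forall fun t v _ => ?_
    have h1 : HasDerivAt (fun v : ℂ => -(v * (t : ℂ))) (-(t : ℂ)) v := by
      simpa using ((hasDerivAt_id v).mul_const (t : ℂ)).fun_neg
    exact (h1.cexp).const_mul _

/-- Both sides are holomorphic in the right half plane and agree on the positive reals, which
accumulate at 1; the identity theorem does the rest. -/
lemma integral_rpow_mul_cexp_neg {a : ℝ} (ha : 0 < a) {w : ℂ} (hw : 0 < w.re) :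
    ∫ t in Set.Ioi (0 : ℝ), ((t ^ (a - 1) : ℝ) : ℂ) * Complex.exp (-(w * t)) =
      w ^ (-(a : ℂ)) * Complex.Gamma a := by
  have hU : IsOpen {w : ℂ | 0 < w.re} := isOpen_lt continuous_const Complex.continuous_re
  have hR : DifferentiableOn ℂ (fun w : ℂ => w ^ (-(a : ℂ)) * Complex.Gamma a) {w | 0 < w.re} := by
    intro v hv
    exact ((differentiableAt_id.cpow_const (Or.inl hv)).mul_const _).differentiableWithinAt
  have hconn : IsPreconnected {w : ℂ | 0 < w.re} :=
    (convex_halfSpace_re_gt 0).isPreconnected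
  refine ((differentiableOn_integral_rpow_mul_exp ha).analyticOnNhd
    hU).eqOn_of_preconnected_of_frequently_eq (hR.analyticOnNhd hU) hconn
    (z₀ := ((1 : ℝ) : ℂ)) (by simp) ?_ hw
  have hreal : ∀ r : ℝ, 0 < r →
      ∫ t in Set.Ioi (0 : ℝ), ((t ^ (a - 1) : ℝ) : ℂ) * Complex.exp (-((r : ℂ) * t)) =
      (r : ℂ) ^ (-(a : ℂ)) * Complex.Gamma a := by
    intro r hr
    have h1 := Complex.integral_cpow_mul_exp_neg_mul_Ioi (a := (a : ℂ)) (by simpa using ha) hr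
    have h2 : (r : ℂ) ^ (-(a : ℂ)) = (1 / (r : ℂ)) ^ (a : ℂ) := by
      rw [one_div, Complex.inv_cpow, Complex.cpow_neg]
      rw [Complex.arg_ofReal_of_nonneg hr.le]
      exact Real.pi_pos.ne
    rw [h2, ← h1]
    refine setIntegral_congr_fun measurableSet_Ioi fun t ht => ?_
    rw [Complex.ofReal_cpow (le_of_lt ht)]
    push_cast
    rfl
  have htend : Tendsto (fun r : ℝ => (r : ℂ)) (𝓝[≠] 1) (𝓝[≠] ((1 : ℝ) : ℂ)) := by
    refine tendsto_nhdsWithin_iff.2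
      ⟨(Complex.continuous_ofReal.tendsto 1).mono_left nhdsWithin_le_nhds, ?_⟩
    filter_upwards [self_mem_nhdsWithin] with r hr
    simpa using hr
  refine htend.frequently (Eventually.frequently ?_)
  filter_upwards [mem_nhdsWithin_of_mem_nhds (lt_mem_nhds zero_lt_one)] with r hr
  exact hreal r hr

/-- The hypothesis keeps a at distance δ from all integers. It survives a ↦ -a and integer shifts,
so the same δ serves all the orders ±a - m at once. -/
lemma norm_lowerGammaSeries_term_le {a δ : ℝ} (hδ : 0 < δ) (ha : ∀ k : ℤ, δ ≤ |a + k|) (w : ℂ)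
    (n : ℕ) :
    ‖(-w) ^ n / ((n.factorial : ℂ) * ((a : ℂ) + n))‖ ≤ δ⁻¹ * (‖w‖ ^ n / n.factorial) := by
  have h1 : δ ≤ ‖(a : ℂ) + n‖ := by
    have := ha n
    rw [← Real.norm_eq_abs, ← Complex.norm_real] at this
    simpa using this
  rw [norm_div, norm_mul, norm_pow, norm_neg, Complex.norm_natCast, div_mul_eq_div_div,
    div_eq_inv_mul _ ‖(a : ℂ) + n‖]
  gcongr

lemma summable_lowerGammaSeries {a δ : ℝ} (hδ : 0 < δ) (ha : ∀ k : ℤ, δ ≤ |a + k|) (w : ℂ) :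
    Summable fun n : ℕ => (-w) ^ n / ((n.factorial : ℂ) * ((a : ℂ) + n)) :=
  Summable.of_norm_bounded ((Real.summable_pow_div_factorial ‖w‖).mul_left _)
    (norm_lowerGammaSeries_term_le hδ ha w)

lemma norm_lowerGammaSeries_le {a δ : ℝ} (hδ : 0 < δ) (ha : ∀ k : ℤ, δ ≤ |a + k|) (w : ℂ) :
    ‖lowerGammaSeries a w‖ ≤ δ⁻¹ * Real.exp ‖w‖ := by
  refine tsum_of_norm_bounded ?_ (norm_lowerGammaSeries_term_le hδ ha w)
  rw [Real.exp_eq_exp_ℝ]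
  exact (NormedSpace.expSeries_div_hasSum_exp ‖w‖).mul_left _

lemma continuous_lowerGammaSeries {a δ : ℝ} (hδ : 0 < δ) (ha : ∀ k : ℤ, δ ≤ |a + k|) :
    Continuous (lowerGammaSeries a) := by
  rw [continuous_iff_continuousAt]
  intro w
  have h : ContinuousOn (lowerGammaSeries a) (Metric.ball 0 (‖w‖ + 1)) := by
    refine continuousOn_tsum (fun n => Continuous.continuousOn (by fun_prop))
      ((Real.summable_pow_div_factorial (‖w‖ + 1)).mul_left δ⁻¹) fun n v hv => ?_
    refine (norm_lowerGammaSeries_term_le hδ ha v n).trans ?_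
    have := (mem_ball_zero_iff.1 hv).le
    gcongr
  exact h.continuousAt (Metric.isOpen_ball.mem_nhds (by simp))

lemma ofReal_ne_zero_of_le_abs {a δ : ℝ} (hδ : 0 < δ) (ha : ∀ k : ℤ, δ ≤ |a + k|) (n : ℕ) :
    (a : ℂ) + n ≠ 0 := by
  have h := ha n
  have : a + n ≠ 0 := by
    intro h0
    simp only [Int.cast_natCast, h0, abs_zero] at h
    linarith
  exact_mod_cast this

/-- Integration by parts at the level of coefficients: 1 - a/(a + n) = n/(a + n), followed by an
index shift. This form also holds for negative a, where the integral over (0,1) diverges. -/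
lemma lowerGammaSeries_recurrence {a δ : ℝ} (hδ : 0 < δ) (ha : ∀ k : ℤ, δ ≤ |a + k|) (w : ℂ) :
    a * lowerGammaSeries a w = Complex.exp (-w) + w * lowerGammaSeries (a + 1) w := by
  have ha1 : ∀ k : ℤ, δ ≤ |a + 1 + k| := fun k => by
    have := ha (1 + k)
    push_cast at this
    rwa [← add_assoc] at this
  have h0 := summable_lowerGammaSeries hδ ha w
  have hexp : HasSum (fun n : ℕ => (-w) ^ n / (n.factorial : ℂ)) (Complex.exp (-w)) := by
    rw [Complex.exp_eq_exp_ℂ]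
    exact NormedSpace.expSeries_div_hasSum_exp (-w)
  have hdiff := hexp.sub (h0.hasSum.mul_left (a : ℂ))
  have hterm : ∀ n : ℕ, (-w) ^ n / (n.factorial : ℂ) -
      a * ((-w) ^ n / ((n.factorial : ℂ) * ((a : ℂ) + n))) =
      n * ((-w) ^ n / ((n.factorial : ℂ) * ((a : ℂ) + n))) := by
    intro n
    have h1 := ofReal_ne_zero_of_le_abs hδ ha n
    have h2 : (n.factorial : ℂ) ≠ 0 := by exact_mod_cast n.factorial_ne_zero
    field_simp
    ring
  simp only [hterm] at hdiff
  have h3 := (hasSum_nat_add_iff' 1).2 hdiff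
  simp only [Finset.range_one, Finset.sum_singleton, Nat.cast_zero, zero_mul, sub_zero] at h3
  have h4 := (summable_lowerGammaSeries hδ ha1 w).hasSum.mul_left (-w)
  have h5 : ∀ n : ℕ, ((n + 1 : ℕ) : ℂ) * ((-w) ^ (n + 1) /
      (((n + 1).factorial : ℂ) * ((a : ℂ) + ((n + 1 : ℕ) : ℂ)))) =
      -w * ((-w) ^ n / ((n.factorial : ℂ) * (((a + 1 : ℝ) : ℂ) + n))) := by
    intro n
    have e1 := ofReal_ne_zero_of_le_abs hδ ha1 n
    have e2 : (n.factorial : ℂ) ≠ 0 := by exact_mod_cast n.factorial_ne_zero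
    have e3 : (n : ℂ) + 1 ≠ 0 := Nat.cast_add_one_ne_zero n
    push_cast at e1
    have e4 : (a : ℂ) + (n + 1) ≠ 0 := by
      intro h; apply e1; rw [← h]; ring
    rw [Nat.factorial_succ]
    push_cast
    rw [show (a : ℂ) + 1 + n = a + (n + 1) by ring]
    field_simp
    ring
  simp only [h5] at h3
  have h6 := h3.unique h4
  simp only [lowerGammaSeries]
  linear_combination -h6

lemma integral_Ioc_rpow_mul_cexp {a : ℝ} (ha : 0 < a) (w : ℂ) :
    ∫ t in Set.Ioc (0 : ℝ) 1, ((t ^ (a - 1) : ℝ) : ℂ) * Complex.exp (-(w * t)) =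
      lowerGammaSeries a w := by
  have hint : ∀ n : ℕ, IntegrableOn (fun t : ℝ => t ^ (a - 1 + n)) (Set.Ioc 0 1) := fun n => by
    rw [← intervalIntegrable_iff_integrableOn_Ioc_of_le zero_le_one]
    exact intervalIntegral.intervalIntegrable_rpow' (by
      have : (0 : ℝ) ≤ n := n.cast_nonneg
      linarith)
  have hval : ∀ n : ℕ, ∫ t in Set.Ioc (0 : ℝ) 1, t ^ (a - 1 + n) = 1 / (a + n) := fun n => by
    have : (0 : ℝ) ≤ n := n.cast_nonneg
    rw [← intervalIntegral.integral_of_le zero_le_one, integral_rpow (Or.inl (by linarith)),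
      Real.one_rpow, Real.zero_rpow (by linarith)]
    ring_nf
  have key := hasSum_integral_of_summable_integral_norm (μ := volume.restrict (Set.Ioc (0 : ℝ) 1))
    (F := fun (n : ℕ) (t : ℝ) => (-w) ^ n / (n.factorial : ℂ) * ((t ^ (a - 1 + n) : ℝ) : ℂ))
    (fun n => (hint n).ofReal.const_mul _) ?_
  · have h1 : ∀ n : ℕ, ∫ t in Set.Ioc (0 : ℝ) 1,
        (-w) ^ n / (n.factorial : ℂ) * ((t ^ (a - 1 + n) : ℝ) : ℂ) =
        (-w) ^ n / ((n.factorial : ℂ) * ((a : ℂ) + n)) := fun n => by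
      rw [integral_const_mul, integral_complex_ofReal, hval]
      push_cast
      rw [div_mul_div_comm, mul_one]
    simp only [h1] at key
    rw [lowerGammaSeries, key.tsum_eq]
    refine setIntegral_congr_fun measurableSet_Ioc fun t ht => ?_
    have h2 : ∀ n : ℕ, (-w) ^ n / (n.factorial : ℂ) * ((t ^ (a - 1 + n) : ℝ) : ℂ) =
        ((t ^ (a - 1) : ℝ) : ℂ) * ((-(w * t)) ^ n / (n.factorial : ℂ)) := fun n => by
      rw [Real.rpow_add ht.1, Real.rpow_natCast, ← neg_mul, mul_pow]
      push_cast
      ring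
    simp only [h2]
    rw [tsum_mul_left, Complex.exp_eq_exp_ℂ, NormedSpace.exp_eq_tsum_div]
  · have h1 : ∀ n : ℕ, ∫ t in Set.Ioc (0 : ℝ) 1,
        ‖(-w) ^ n / (n.factorial : ℂ) * ((t ^ (a - 1 + n) : ℝ) : ℂ)‖ =
        ‖w‖ ^ n / n.factorial * (1 / (a + n)) := fun n => by
      rw [← hval n, ← integral_const_mul]
      refine setIntegral_congr_fun measurableSet_Ioc fun t ht => ?_
      have := Real.rpow_nonneg ht.1.le (a - 1 + n)
      simp [abs_of_nonneg this]
    simp only [h1]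
    refine Summable.of_nonneg_of_le (fun n => by positivity) (fun n => ?_)
      ((Real.summable_pow_div_factorial ‖w‖).mul_right (1 / a))
    gcongr
    simp

/-- Integrate the derivative of t^a e^{-wt} over (1, ∞). No sign of a is needed because the
singularity at 0 is cut off. -/
lemma upperGamma_recurrence (a : ℝ) {w : ℂ} (hw : 0 < w.re) :
    a * upperGamma a w = -Complex.exp (-w) + w * upperGamma (a + 1) w := by
  have hd : ∀ t ∈ Set.Ici (1 : ℝ), HasDerivAt
      (fun t : ℝ => ((t ^ a : ℝ) : ℂ) * Complex.exp (-(w * t)))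
      (a * (((t ^ (a - 1) : ℝ) : ℂ) * Complex.exp (-(w * t))) -
        w * (((t ^ (a + 1 - 1) : ℝ) : ℂ) * Complex.exp (-(w * t)))) t := by
    intro t ht
    have ht0 : t ≠ 0 := (zero_lt_one.trans_le ht).ne'
    have h1 := (Real.hasDerivAt_rpow_const (p := a) (Or.inl ht0)).ofReal_comp
    have h2 : HasDerivAt (fun t : ℝ => -(w * (t : ℂ))) (-w) t := by
      simpa using ((Complex.ofRealCLM.hasDerivAt (x := t)).const_mul w).fun_neg
    convert! h1.mul h2.cexp using 1
    rw [add_sub_cancel_right]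
    push_cast
    ring
  have hi1 := (integrableOn_Ioi_one_rpow_mul_exp (a - 1) hw).const_mul (a : ℂ)
  have hi2 := (integrableOn_Ioi_one_rpow_mul_exp (a + 1 - 1) hw).const_mul w
  have hlim : Tendsto (fun t : ℝ => ((t ^ a : ℝ) : ℂ) * Complex.exp (-(w * t))) atTop (𝓝 0) := by
    rw [tendsto_zero_iff_norm_tendsto_zero]
    refine (tendsto_rpow_mul_exp_neg_mul_atTop_nhds_zero a w.re hw).congr' ?_
    filter_upwards [eventually_gt_atTop 0] with t ht
    rw [norm_rpow_mul_exp ht, neg_mul]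
  have h := integral_Ioi_of_hasDerivAt_of_tendsto' hd (hi1.sub hi2) hlim
  rw [integral_sub hi1 hi2, integral_const_mul, integral_const_mul] at h
  simp only [Real.one_rpow, Complex.ofReal_one, one_mul, mul_one, zero_sub] at h
  simp only [upperGamma]
  linear_combination h

/-- For a > 0 this is the Gamma integral split at 1. Both sides obey the same recurrence linking a
to a + 1, and a ≠ 0 can be divided out, so induction on N > -a descends to negative orders. -/
lemma upperGamma_eq_of_re_pos {a δ : ℝ} (hδ : 0 < δ) (ha : ∀ k : ℤ, δ ≤ |a + k|) {w : ℂ}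
    (hw : 0 < w.re) :
    upperGamma a w = w ^ (-(a : ℂ)) * Complex.Gamma a - lowerGammaSeries a w := by
  obtain ⟨N, hN⟩ := exists_nat_gt (-a)
  induction N generalizing a with
  | zero =>
    have ha0 : 0 < a := by simpa using hN
    rw [← integral_rpow_mul_cexp_neg ha0 hw, ← integral_Ioc_rpow_mul_cexp ha0,
      eq_sub_iff_add_eq', ← Set.Ioc_union_Ioi_eq_Ioi (zero_le_one' ℝ), setIntegral_union
      (Set.Ioc_disjoint_Ioi le_rfl) measurableSet_Ioi]
    · rfl
    · exact (integrableOn_Ioi_zero_rpow_mul_exp (by linarith) hw).mono_set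
        Set.Ioc_subset_Ioi_self
    · exact integrableOn_Ioi_one_rpow_mul_exp _ hw
  | succ N ih =>
    have ha1 : ∀ k : ℤ, δ ≤ |a + 1 + k| := fun k => by
      have := ha (1 + k)
      push_cast at this
      rwa [← add_assoc] at this
    have h1 := ih ha1 (by push_cast at hN; linarith)
    have hane : (a : ℂ) ≠ 0 := by simpa using ofReal_ne_zero_of_le_abs hδ ha 0
    have hwne : w ≠ 0 := by
      rintro rfl
      simp at hw
    have h2 := upperGamma_recurrence a hw
    have h3 := lowerGammaSeries_recurrence hδ ha w
    have h4 : w * w ^ (-((a + 1 : ℝ) : ℂ)) = w ^ (-(a : ℂ)) := by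
      push_cast
      rw [neg_add, Complex.cpow_add _ _ hwne, Complex.cpow_neg_one]
      field_simp
    have h5 : Complex.Gamma ((a + 1 : ℝ) : ℂ) = a * Complex.Gamma a := by
      push_cast
      exact Complex.Gamma_add_one _ hane
    refine mul_left_cancel₀ hane ?_
    rw [h2, h1, h5]
    linear_combination h3 + a * Complex.Gamma a * h4

/-- Boundary case of the half plane, obtained from w + ε as ε → 0⁺. The condition a < 0 makes
t^{a-1} an integrable majorant on (1, ∞) without exponential decay. -/
lemma upperGamma_eq {a δ : ℝ} (hδ : 0 < δ) (ha : ∀ k : ℤ, δ ≤ |a + k|) (ha0 : a < 0) {w : ℂ}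
    (hw : 0 ≤ w.re) (hw0 : w ≠ 0) :
    upperGamma a w = w ^ (-(a : ℂ)) * Complex.Gamma a - lowerGammaSeries a w := by
  have hslit : w ∈ Complex.slitPlane := by
    rcases hw.lt_or_eq with h | h
    · exact Or.inl h
    · exact Or.inr fun h' => hw0 (Complex.ext h.symm h')
  have hlim : Tendsto (fun ε : ℝ => w + (ε : ℂ)) (𝓝[>] 0) (𝓝 w) := by
    have : Tendsto (fun ε : ℝ => w + (ε : ℂ)) (𝓝 0) (𝓝 (w + ((0 : ℝ) : ℂ))) :=
      Continuous.tendsto (by fun_prop) 0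
    simp only [Complex.ofReal_zero, add_zero] at this
    exact this.mono_left nhdsWithin_le_nhds
  have hR : Tendsto (fun ε : ℝ => (w + (ε : ℂ)) ^ (-(a : ℂ)) * Complex.Gamma a -
      lowerGammaSeries a (w + ε)) (𝓝[>] 0)
      (𝓝 (w ^ (-(a : ℂ)) * Complex.Gamma a - lowerGammaSeries a w)) := by
    have hc : ContinuousAt (fun v : ℂ => v ^ (-(a : ℂ)) * Complex.Gamma a -
        lowerGammaSeries a v) w :=
      ((continuousAt_id.cpow continuousAt_const hslit).mul_const _).sub
        (continuous_lowerGammaSeries hδ ha).continuousAt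
    exact hc.tendsto.comp hlim
  have hL : Tendsto (fun ε : ℝ => upperGamma a (w + ε)) (𝓝[>] 0) (𝓝 (upperGamma a w)) := by
    refine tendsto_integral_filter_of_dominated_convergence (fun t : ℝ => t ^ (a - 1))
      (Eventually.of_forall fun ε => (measurable_rpow_mul_exp _ _).aestronglyMeasurable) ?_
      (integrableOn_Ioi_rpow_of_lt (by linarith) zero_lt_one) ?_
    · filter_upwards [self_mem_nhdsWithin] with ε hε
      filter_upwards [ae_restrict_mem measurableSet_Ioi] with t ht
      have ht0 : 0 < t := zero_lt_one.trans ht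
      rw [norm_rpow_mul_exp ht0]
      refine mul_le_of_le_one_right (by positivity) (Real.exp_le_one_iff.2 ?_)
      have hε' : 0 < ε := hε
      have : 0 ≤ (w + (ε : ℂ)).re * t := by
        simp only [Complex.add_re, Complex.ofReal_re]
        positivity
      linarith
    · refine Eventually.of_forall fun t => ?_
      exact ((Continuous.tendsto (by fun_prop : Continuous fun v : ℂ =>
        ((t ^ (a - 1) : ℝ) : ℂ) * Complex.exp (-(v * t))) w).comp hlim)
  refine tendsto_nhds_unique hL (hR.congr' ?_)
  filter_upwards [self_mem_nhdsWithin] with ε hε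
  refine (upperGamma_eq_of_re_pos hδ ha ?_).symm
  have : 0 < ε := hε
  simp only [Complex.add_re, Complex.ofReal_re]
  linarith

/-! ### The integral representation of `K_1` -/

/-- The integral `∫_0^∞ t^{a-1} e^{-t-w/t} dt`, which equals `2 w^{a/2} K_a(2√w)`. -/
noncomputable def besselIntegral (a : ℝ) (w : ℂ) : ℂ :=
  ∫ t in Set.Ioi (0 : ℝ), ((t ^ (a - 1) : ℝ) : ℂ) * Complex.exp (-(t + w / t))

lemma norm_cexp_neg_add_div_le {w : ℂ} (hw : 0 ≤ w.re) {t : ℝ} (ht : 0 < t) :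
    ‖Complex.exp (-(t + w / t))‖ ≤ Real.exp (-t) := by
  rw [Complex.norm_exp, Real.exp_le_exp]
  simp only [Complex.neg_re, Complex.add_re, Complex.ofReal_re, Complex.div_ofReal_re]
  have : 0 ≤ w.re / t := by positivity
  linarith

lemma norm_besselIntegrand_le (a : ℝ) {w : ℂ} (hw : 0 ≤ w.re) {t : ℝ} (ht : 0 < t) :
    ‖((t ^ (a - 1) : ℝ) : ℂ) * Complex.exp (-(t + w / t))‖ ≤ t ^ (a - 1) * Real.exp (-(1 * t)) := by
  rw [norm_mul, Complex.norm_real, Real.norm_of_nonneg (by positivity), one_mul]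
  gcongr
  exact norm_cexp_neg_add_div_le hw ht

lemma measurable_besselIntegrand (a : ℝ) (w : ℂ) :
    Measurable fun t : ℝ => ((t ^ (a - 1) : ℝ) : ℂ) * Complex.exp (-(t + w / t)) := by
  fun_prop

lemma integrableOn_besselIntegrand {a : ℝ} (ha : 0 < a) {w : ℂ} (hw : 0 ≤ w.re) :
    IntegrableOn (fun t : ℝ => ((t ^ (a - 1) : ℝ) : ℂ) * Complex.exp (-(t + w / t)))
      (Set.Ioi 0) := by
  refine Integrable.mono' (integrableOn_rpow_mul_exp_neg (b := a - 1) (by linarith) zero_lt_one)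
    (measurable_besselIntegrand a w).aestronglyMeasurable ?_
  filter_upwards [ae_restrict_mem measurableSet_Ioi] with t ht
  exact norm_besselIntegrand_le a hw ht

/-- Expand e^{-c/t}. On t > 1 the powers t^{-m} are at most 1, so integrability for m = 0 controls
all terms and the norms sum to at most e^{|c|} times that integral. -/
lemma hasSum_upperGamma_sub_nat {a : ℝ} {w : ℂ} (c : ℂ)
    (h : IntegrableOn (fun t : ℝ => t ^ (a - 1) * Real.exp (-(w.re * t))) (Set.Ioi 1)) :
    HasSum (fun m : ℕ => (-c) ^ m / (m.factorial : ℂ) * upperGamma (a - m) w)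
      (∫ t in Set.Ioi (1 : ℝ), ((t ^ (a - 1) : ℝ) : ℂ) * Complex.exp (-(w * t + c / t))) := by
  have hle : ∀ m : ℕ, ∀ t ∈ Set.Ioi (1 : ℝ),
      t ^ (a - m - 1) * Real.exp (-(w.re * t)) ≤ t ^ (a - 1) * Real.exp (-(w.re * t)) := by
    intro m t ht
    have : (1 : ℝ) ≤ t := le_of_lt ht
    gcongr
    simp
  have hint : ∀ m : ℕ, IntegrableOn
      (fun t : ℝ => ((t ^ (a - m - 1) : ℝ) : ℂ) * Complex.exp (-(w * t))) (Set.Ioi 1) := by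
    intro m
    refine Integrable.mono' h (measurable_rpow_mul_exp _ w).aestronglyMeasurable ?_
    filter_upwards [ae_restrict_mem measurableSet_Ioi] with t ht
    rw [norm_rpow_mul_exp (zero_lt_one.trans ht)]
    exact hle m t ht
  have key := hasSum_integral_of_summable_integral_norm (μ := volume.restrict (Set.Ioi (1 : ℝ)))
    (F := fun (m : ℕ) (t : ℝ) => (-c) ^ m / (m.factorial : ℂ) *
      (((t ^ (a - m - 1) : ℝ) : ℂ) * Complex.exp (-(w * t))))
    (fun m => (hint m).const_mul _) ?_
  · simp only [integral_const_mul] at key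
    convert! key using 1
    refine setIntegral_congr_fun measurableSet_Ioi fun t ht => ?_
    have ht0 : (0 : ℝ) < t := zero_lt_one.trans ht
    have h2 : ∀ m : ℕ, (-c) ^ m / (m.factorial : ℂ) *
        (((t ^ (a - m - 1) : ℝ) : ℂ) * Complex.exp (-(w * t))) =
        ((t ^ (a - 1) : ℝ) : ℂ) * Complex.exp (-(w * t)) *
          ((-(c / t)) ^ m / (m.factorial : ℂ)) := fun m => by
      rw [show a - m - 1 = a - 1 - m by ring, Real.rpow_sub ht0, Real.rpow_natCast, ← neg_div,
        div_pow]
      push_cast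
      ring
    simp only [h2]
    have h3 : Complex.exp (-(c / t)) = ∑' m : ℕ, (-(c / t)) ^ m / (m.factorial : ℂ) := by
      rw [Complex.exp_eq_exp_ℂ, NormedSpace.exp_eq_tsum_div]
    rw [tsum_mul_left, neg_add, Complex.exp_add, ← mul_assoc, h3]

  · refine Summable.of_nonneg_of_le (fun m => by positivity) (fun m => ?_)
      ((Real.summable_pow_div_factorial ‖c‖).mul_right
        (∫ t in Set.Ioi (1 : ℝ), t ^ (a - 1) * Real.exp (-(w.re * t))))
    rw [← integral_const_mul]
    refine setIntegral_mono_on ((hint m).const_mul _).norm (h.const_mul _) measurableSet_Ioi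
      fun t ht => ?_
    rw [norm_mul, norm_rpow_mul_exp (zero_lt_one.trans ht), norm_div, norm_pow, norm_neg,
      Complex.norm_natCast]
    exact mul_le_mul_of_nonneg_left (hle m t ht) (by positivity)

/-- The inversion t ↦ 1/t exchanges the two exponentials and changes the order a into -a, so both
halves can be expanded over (1, ∞). -/
lemma integral_Ioc_besselIntegrand (a : ℝ) (w : ℂ) :
    ∫ t in Set.Ioc (0 : ℝ) 1, ((t ^ (a - 1) : ℝ) : ℂ) * Complex.exp (-(t + w / t)) =
      ∫ t in Set.Ioi (1 : ℝ), ((t ^ (-a - 1) : ℝ) : ℂ) * Complex.exp (-(w * t + 1 / t)) := by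
  have himg : (fun t : ℝ => t⁻¹) '' Set.Ioi 1 = Set.Ioo 0 1 := by
    rw [Set.image_inv_eq_inv, Set.inv_Ioi₀ zero_lt_one, inv_one]
  rw [integral_Ioc_eq_integral_Ioo, ← himg,
    integral_image_eq_integral_abs_deriv_smul measurableSet_Ioi
      (fun t ht => (hasDerivAt_inv (zero_lt_one.trans ht).ne').hasDerivWithinAt)
      inv_injective.injOn]
  refine setIntegral_congr_fun measurableSet_Ioi fun t ht => ?_
  have ht0 : (0 : ℝ) < t := zero_lt_one.trans ht
  have h1 : |-(t ^ 2)⁻¹| * t⁻¹ ^ (a - 1) = t ^ (-a - 1) := by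
    rw [abs_neg, abs_of_pos (by positivity), Real.inv_rpow ht0.le, ← Real.rpow_neg ht0.le,
      ← Real.rpow_natCast, ← Real.rpow_neg ht0.le, ← Real.rpow_add ht0]
    congr 1
    push_cast
    ring
  simp only [Complex.real_smul]
  rw [← mul_assoc, ← Complex.ofReal_mul, h1]
  congr 2
  push_cast
  rw [div_inv_eq_mul]
  ring

lemma le_abs_add_int {a : ℝ} (h0 : 0 < a) (h1 : a < 1) (k : ℤ) : min a (1 - a) ≤ |a + k| := by
  rcases le_or_gt 0 k with h | h
  · have : (0 : ℝ) ≤ k := by exact_mod_cast h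
    rw [abs_of_nonneg (by linarith)]
    linarith [min_le_left a (1 - a)]
  · have : (k : ℝ) ≤ -1 := by exact_mod_cast (by omega : k ≤ -1)
    rw [abs_of_nonpos (by linarith)]
    linarith [min_le_right a (1 - a)]

lemma le_abs_sub_nat_add_int {a δ : ℝ} (h : ∀ k : ℤ, δ ≤ |a + k|) (m : ℕ) (k : ℤ) :
    δ ≤ |a - m + k| := by
  have := h (k - m)
  push_cast at this
  rwa [show a + ((k : ℝ) - m) = a - m + k by ring] at this

lemma le_abs_neg_add_int {a δ : ℝ} (h : ∀ k : ℤ, δ ≤ |a + k|) (k : ℤ) : δ ≤ |-a + k| := by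
  have := h (-k)
  push_cast at this
  rwa [← abs_neg, neg_add, neg_neg] at this

lemma summable_pow_div_factorial_mul_lowerGammaSeries {a δ : ℝ} (hδ : 0 < δ)
    (h : ∀ k : ℤ, δ ≤ |a + k|) (c w : ℂ) :
    Summable fun m : ℕ => (-c) ^ m / (m.factorial : ℂ) * lowerGammaSeries (a - m) w := by
  refine Summable.of_norm_bounded
    ((Real.summable_pow_div_factorial ‖c‖).mul_right (δ⁻¹ * Real.exp ‖w‖)) fun m => ?_
  rw [norm_mul, norm_div, norm_pow, norm_neg, Complex.norm_natCast]
  gcongr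
  exact norm_lowerGammaSeries_le hδ (le_abs_sub_nat_add_int h m) w

/-- Both sides are one absolutely convergent double series summed in the two orders; the
denominators are a - m + n and -a - n + m, whence the sign. -/
lemma tsum_lowerGammaSeries_cancel {a δ : ℝ} (hδ : 0 < δ) (h : ∀ k : ℤ, δ ≤ |a + k|) (w : ℂ) :
    (∑' m : ℕ, (-w) ^ m / (m.factorial : ℂ) * lowerGammaSeries (a - m) 1) =
      -∑' m : ℕ, (-1 : ℂ) ^ m / (m.factorial : ℂ) * lowerGammaSeries (-a - m) w := by
  have hs : Summable (Function.uncurry fun m n : ℕ => (-w) ^ m / (m.factorial : ℂ) *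
      ((-1 : ℂ) ^ n / ((n.factorial : ℂ) * (((a - m : ℝ) : ℂ) + n)))) := by
    refine Summable.of_norm_bounded (((Real.summable_pow_div_factorial ‖w‖).mul_of_nonneg
      (Real.summable_pow_div_factorial 1) (fun m => by positivity) fun n => by
        positivity).mul_left δ⁻¹) ?_
    rintro ⟨m, n⟩
    have h1 := norm_lowerGammaSeries_term_le hδ (le_abs_sub_nat_add_int h m) 1 n
    simp only [Function.uncurry_apply_pair]
    rw [norm_mul, norm_div, norm_pow, norm_neg, Complex.norm_natCast]
    calc _ ≤ ‖w‖ ^ m / m.factorial * (δ⁻¹ * (‖(1 : ℂ)‖ ^ n / n.factorial)) := by gcongr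
      _ = _ := by rw [norm_one]; ring
  simp only [lowerGammaSeries, ← tsum_mul_left]
  rw [← hs.tsum_comm, ← tsum_neg]
  refine tsum_congr fun n => ?_
  rw [← tsum_neg]
  refine tsum_congr fun m => ?_
  have h2 : (((-a - n : ℝ) : ℂ) + m) = -(((a - m : ℝ) : ℂ) + n) := by push_cast; ring
  rw [h2, mul_neg, div_neg, mul_neg, neg_neg]
  simp only [div_eq_mul_inv, mul_inv]
  ring

/-- The expansion of `2 w^{a/2} K_a(2√w)` in powers of `w`. -/
lemma exists_hasSum_besselIntegral {a : ℝ} (h0 : 0 < a) (h1 : a < 1) {w : ℂ}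
    (hw : 0 ≤ w.re) (hw0 : w ≠ 0) :
    ∃ A B : ℂ, HasSum (fun m : ℕ => (-w) ^ m / (m.factorial : ℂ) * Complex.Gamma (a - m)) A ∧
      HasSum (fun m : ℕ => (-w) ^ m / (m.factorial : ℂ) * Complex.Gamma (-a - m)) B ∧
      besselIntegral a w = A + w ^ (a : ℂ) * B := by
  have hδ : 0 < min a (1 - a) := lt_min h0 (by linarith)
  have hd := le_abs_add_int h0 h1
  have hd' := le_abs_neg_add_int hd
  have hA := hasSum_upperGamma_sub_nat (a := a) (w := 1) w (by
    simpa using (integrableOn_rpow_mul_exp_neg (b := a - 1) (by linarith) zero_lt_one).mono_set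
      (Set.Ioi_subset_Ioi zero_le_one))
  -- Here Re w may be 0; the exponent -a - 1 < -1 alone gives integrability.
  have hB := hasSum_upperGamma_sub_nat (a := -a) (w := w) 1 (by
    refine Integrable.mono' (integrableOn_Ioi_rpow_of_lt (by linarith : -a - 1 < -1) zero_lt_one)
      (Measurable.aestronglyMeasurable (by fun_prop)) ?_
    filter_upwards [ae_restrict_mem measurableSet_Ioi] with t ht
    have ht0 : (0 : ℝ) < t := zero_lt_one.trans ht
    rw [Real.norm_of_nonneg (by positivity)]
    have : 0 ≤ w.re * t := by positivity
    exact mul_le_of_le_one_right (by positivity) (Real.exp_le_one_iff.2 (by linarith)))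
  -- Adding the lower series completes every incomplete Gamma term; the two added sums cancel in the
  -- end.
  have hA' := hA.add (summable_pow_div_factorial_mul_lowerGammaSeries hδ hd w 1).hasSum
  have hB' := hB.add (summable_pow_div_factorial_mul_lowerGammaSeries hδ hd' 1 w).hasSum
  have eA : ∀ m : ℕ, (-w) ^ m / (m.factorial : ℂ) * upperGamma (a - m) 1 +
      (-w) ^ m / (m.factorial : ℂ) * lowerGammaSeries (a - m) 1 =
      (-w) ^ m / (m.factorial : ℂ) * Complex.Gamma (a - m) := fun m => by
    rw [upperGamma_eq_of_re_pos hδ (le_abs_sub_nat_add_int hd m) (by simp), Complex.one_cpow]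
    push_cast
    ring
  have hpow : w ^ (a : ℂ) ≠ 0 := by simp [Complex.cpow_eq_zero_iff, hw0]
  have eB : ∀ m : ℕ, (-1) ^ m / (m.factorial : ℂ) * upperGamma (-a - m) w +
      (-1) ^ m / (m.factorial : ℂ) * lowerGammaSeries (-a - m) w =
      w ^ (a : ℂ) * ((-w) ^ m / (m.factorial : ℂ) * Complex.Gamma (-a - m)) := fun m => by
    have hm : (0 : ℝ) ≤ m := m.cast_nonneg
    rw [upperGamma_eq hδ (le_abs_sub_nat_add_int hd' m) (by linarith) hw hw0]
    have e1 : w ^ (-((-a - m : ℝ) : ℂ)) = w ^ (a : ℂ) * w ^ m := by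
      rw [← Complex.cpow_natCast, ← Complex.cpow_add _ _ hw0]
      push_cast
      congr 1
      ring
    rw [e1, neg_pow w m]
    push_cast
    ring
  simp only [eA] at hA'
  simp only [eB] at hB'
  have hB'' := hB'.mul_left (w ^ (a : ℂ))⁻¹
  simp only [inv_mul_cancel_left₀ hpow] at hB''
  refine ⟨_, _, hA', hB'', ?_⟩
  rw [mul_inv_cancel_left₀ hpow, tsum_lowerGammaSeries_cancel hδ hd w, besselIntegral,
    ← Set.Ioc_union_Ioi_eq_Ioi (zero_le_one' ℝ), setIntegral_union
      (Set.Ioc_disjoint_Ioi le_rfl) measurableSet_Ioi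
      ((integrableOn_besselIntegrand h0 hw).mono_set Set.Ioc_subset_Ioi_self)
      ((integrableOn_besselIntegrand h0 hw).mono_set (Set.Ioi_subset_Ioi zero_le_one)),
    integral_Ioc_besselIntegrand]
  simp only [one_mul]
  ring

/-- The reflection formula at a - m and -a - m turns the coefficients 1/Γ of I_{∓a} into the Gamma
values in the expansion of the integral. -/
lemma pi_div_sin_mul_inv_Gamma {a : ℝ} (h0 : 0 < a) (h1 : a < 1) (m : ℕ) :
    (Real.pi : ℂ) / (Real.sin (a * Real.pi) : ℂ) * (Complex.Gamma (-(a : ℂ) + m + 1))⁻¹ =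
        (-1) ^ m * Complex.Gamma (a - m) ∧
      (Real.pi : ℂ) / (Real.sin (a * Real.pi) : ℂ) * (Complex.Gamma ((a : ℂ) + m + 1))⁻¹ =
        -((-1) ^ m * Complex.Gamma (-a - m)) := by
  have hsin : ((Real.sin (a * Real.pi) : ℝ) : ℂ) ≠ 0 := by
    exact_mod_cast (Real.sin_pos_of_pos_of_lt_pi (by positivity)
      (by nlinarith [Real.pi_pos])).ne'
  have hm : (0 : ℝ) ≤ m := m.cast_nonneg
  have hsin' : Complex.sin (Real.pi * ((a : ℂ) - m)) =
      (-1) ^ m * (Real.sin (a * Real.pi) : ℂ) := by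
    rw [show (Real.pi : ℂ) * ((a : ℂ) - m) = ((a * Real.pi - m * Real.pi : ℝ) : ℂ) by
      push_cast; ring, ← Complex.ofReal_sin, Real.sin_sub_nat_mul_pi]
    push_cast
    rfl
  have hsin'' : Complex.sin (Real.pi * (-(a : ℂ) - m)) =
      -((-1) ^ m * (Real.sin (a * Real.pi) : ℂ)) := by
    rw [show (Real.pi : ℂ) * (-(a : ℂ) - m) = ((-(a * Real.pi) - m * Real.pi : ℝ) : ℂ) by
      push_cast; ring, ← Complex.ofReal_sin, Real.sin_sub_nat_mul_pi, Real.sin_neg]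
    push_cast
    ring
  generalize ((Real.sin (a * Real.pi) : ℝ) : ℂ) = σ at hsin hsin' hsin'' ⊢
  constructor
  · have hne : Complex.Gamma (-(a : ℂ) + m + 1) ≠ 0 := by
      apply Complex.Gamma_ne_zero_of_re_pos
      simp
      linarith
    have hr := Complex.Gamma_mul_Gamma_one_sub ((a : ℂ) - m)
    rw [hsin', show (1 : ℂ) - (a - m) = -a + m + 1 by ring, eq_div_iff (by simp [hsin])] at hr
    field_simp
    linear_combination -hr
  · have hne : Complex.Gamma ((a : ℂ) + m + 1) ≠ 0 := by
      apply Complex.Gamma_ne_zero_of_re_pos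
      simp
      linarith
    have hr := Complex.Gamma_mul_Gamma_one_sub (-(a : ℂ) - m)
    rw [hsin'', show (1 : ℂ) - (-a - m) = a + m + 1 by ring, eq_div_iff (by simp [hsin])] at hr
    field_simp
    linear_combination -hr

lemma besselKQuotient_two_sqrt {a : ℝ} (h0 : 0 < a) (h1 : a < 1) {w : ℂ}
    (hw : 0 ≤ w.re) (hw0 : w ≠ 0) :
    2 * Complex.sqrt w ^ (a : ℂ) * besselKQuotient (2 * Complex.sqrt w) a = besselIntegral a w := by
  obtain ⟨A, B, hA, hB, hJ⟩ := exists_hasSum_besselIntegral h0 h1 hw hw0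
  set ζ := Complex.sqrt w with hζ
  have hζ0 : ζ ≠ 0 := by
    rw [hζ, Complex.sqrt]
    simp [Complex.cpow_eq_zero_iff, hw0]
  have hsq : ζ ^ 2 = w := by
    rw [hζ, Complex.sqrt]
    exact Complex.cpow_ofNat_inv_pow w 2
  -- Half of a principal argument is again principal, so log ζ = (log w)/2 and no branch jump
  -- occurs.
  have hcp : ζ ^ (a : ℂ) * ζ ^ (a : ℂ) = w ^ (a : ℂ) := by
    have hlog : Complex.log ζ = Complex.log w / 2 := by
      rw [hζ, Complex.sqrt, Complex.cpow_def_of_ne_zero hw0, Complex.log_exp, div_eq_mul_inv]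
      · simp [Complex.log_im]
        linarith [Complex.neg_pi_lt_arg w, Real.pi_pos]
      · simp [Complex.log_im]
        linarith [Complex.arg_le_pi w, Real.pi_pos]
    rw [Complex.cpow_def_of_ne_zero hζ0, Complex.cpow_def_of_ne_zero hw0, ← Complex.exp_add, hlog]
    congr 1
    ring
  obtain ⟨u, hu, hb⟩ := exists_summable_bound_besselI_term (z := 2 * ζ) (mul_ne_zero two_ne_zero hζ0)
  have hn : ‖(a : ℂ)‖ ≤ 2 := by
    rw [Complex.norm_real, Real.norm_of_nonneg h0.le]
    linarith
  have hI1 : HasSum _ (besselI (a : ℂ) (2 * ζ)) :=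
    (Summable.of_norm_bounded hu fun m => hb m (a : ℂ) hn).hasSum
  have hI2 : HasSum _ (besselI (-(a : ℂ)) (2 * ζ)) :=
    (Summable.of_norm_bounded hu fun m => hb m (-(a : ℂ)) (by rwa [norm_neg])).hasSum
  have hcancel : 2 * ζ / 2 = ζ := by field_simp
  rw [hcancel] at hI1 hI2
  have hK := (hI2.sub hI1).mul_left
    (ζ ^ (a : ℂ) * ((Real.pi : ℂ) / (Real.sin (a * Real.pi) : ℂ)))
  have hAB := hA.add (hB.mul_left (w ^ (a : ℂ)))
  rw [← hJ] at hAB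
  have hterm : ∀ m : ℕ, ζ ^ (a : ℂ) * ((Real.pi : ℂ) / (Real.sin (a * Real.pi) : ℂ)) *
      (ζ ^ (-(a : ℂ) + 2 * (m : ℂ)) / ((m.factorial : ℂ) * Complex.Gamma (-(a : ℂ) + m + 1)) -
        ζ ^ ((a : ℂ) + 2 * (m : ℂ)) / ((m.factorial : ℂ) * Complex.Gamma ((a : ℂ) + m + 1))) =
      (-w) ^ m / (m.factorial : ℂ) * Complex.Gamma (a - m) +
        w ^ (a : ℂ) * ((-w) ^ m / (m.factorial : ℂ) * Complex.Gamma (-a - m)) := by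
    intro m
    obtain ⟨e1, e2⟩ := pi_div_sin_mul_inv_Gamma h0 h1 m
    have e3 : ζ ^ (a : ℂ) * ζ ^ (-(a : ℂ)) = 1 := by
      rw [← Complex.cpow_add _ _ hζ0, add_neg_cancel, Complex.cpow_zero]
    rw [cpow_add_two_mul_nat hζ0, cpow_add_two_mul_nat hζ0, hsq, neg_pow w m]
    simp only [div_eq_mul_inv, mul_inv] at e1 e2 ⊢
    linear_combination w ^ m * (m.factorial : ℂ)⁻¹ * ζ ^ (a : ℂ) * ζ ^ (-(a : ℂ)) * e1 -
      w ^ m * (m.factorial : ℂ)⁻¹ * ζ ^ (a : ℂ) * ζ ^ (a : ℂ) * e2 +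
      w ^ m * (m.factorial : ℂ)⁻¹ * ((-1) ^ m * Complex.Gamma (a - m)) * e3 +
      w ^ m * (m.factorial : ℂ)⁻¹ * ((-1) ^ m * Complex.Gamma (-a - m)) * hcp
  simp only [hterm] at hK
  rw [← hK.unique hAB, besselKQuotient]
  ring

lemma tendsto_besselIntegral_order {w : ℂ} (hw : 0 ≤ w.re) :
    Tendsto (fun a : ℝ => besselIntegral a w) (𝓝[<] 1) (𝓝 (besselIntegral 1 w)) := by
  -- For 1/2 < a < 1 the power t^{a-1} is at most t^{-1/2} on t < 1 and at most 1 on t ≥ 1; the sum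
  -- of the two bounds serves everywhere.
  have hI : IntegrableOn (fun t : ℝ => t ^ ((1 / 2 : ℝ) - 1) * Real.exp (-(1 * t)) +
      t ^ ((1 : ℝ) - 1) * Real.exp (-(1 * t))) (Set.Ioi 0) :=
    (integrableOn_rpow_mul_exp_neg (by norm_num) zero_lt_one).add
      (integrableOn_rpow_mul_exp_neg (by norm_num) zero_lt_one)
  refine tendsto_integral_filter_of_dominated_convergence _
    (Eventually.of_forall fun a => (measurable_besselIntegrand a w).aestronglyMeasurable) ?_ hI ?_
  · filter_upwards [Ioo_mem_nhdsLT (by norm_num : (1 / 2 : ℝ) < 1)] with a ha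
    filter_upwards [ae_restrict_mem measurableSet_Ioi] with t ht
    have ht0 : (0 : ℝ) < t := ht
    refine (norm_besselIntegrand_le a hw ht).trans ?_
    rw [← add_mul]
    gcongr
    rcases le_or_gt 1 t with h | h
    · refine (Real.rpow_le_rpow_of_exponent_le h (by linarith [ha.2] : a - 1 ≤ 1 - 1)).trans ?_
      exact le_add_of_nonneg_left (by positivity)
    · refine (Real.rpow_le_rpow_of_exponent_ge ht0 h.le
        (by linarith [ha.1] : (1 / 2 : ℝ) - 1 ≤ a - 1)).trans ?_
      exact le_add_of_nonneg_right (by positivity)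
  · filter_upwards [ae_restrict_mem measurableSet_Ioi] with t ht
    have ht0 : (0 : ℝ) < t := ht
    refine Tendsto.mono_left ?_ nhdsWithin_le_nhds
    have hc : Continuous fun a : ℝ => ((t ^ (a - 1) : ℝ) : ℂ) * Complex.exp (-(t + w / t)) := by
      have : Continuous fun a : ℝ => t ^ (a - 1) :=
        continuous_const.rpow (by fun_prop) fun _ => Or.inl ht0.ne'
      fun_prop
    exact hc.tendsto 1

/-- `2 √w K_1(2√w) = ∫_0^∞ e^{-t-w/t} dt` for `w ≠ 0` in the closed right half plane. -/
theorem two_mul_sqrt_mul_besselK1 {w : ℂ} (hw : 0 ≤ w.re) (hw0 : w ≠ 0) :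
    2 * Complex.sqrt w * besselK1 (2 * Complex.sqrt w) = besselIntegral 1 w := by
  have hζ0 : Complex.sqrt w ≠ 0 := by
    rw [Complex.sqrt]
    simp [Complex.cpow_eq_zero_iff, hw0]
  -- The limit defining K_1 is two-sided, but the integral formula is known only for orders below 1;
  -- the left limit suffices.
  have hK := (tendsto_besselKQuotient (mul_ne_zero two_ne_zero hζ0)).mono_left
    (nhdsWithin_mono 1 fun a (ha : a < 1) => ne_of_lt ha)
  have hp : Tendsto (fun a : ℝ => 2 * Complex.sqrt w ^ (a : ℂ)) (𝓝[<] 1)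
      (𝓝 (2 * Complex.sqrt w)) := by
    have hc : Continuous fun a : ℝ => 2 * Complex.sqrt w ^ (a : ℂ) :=
      continuous_const.mul (Continuous.const_cpow (by fun_prop) (Or.inl hζ0))
    have := (hc.tendsto 1).mono_left (nhdsWithin_le_nhds (s := Set.Iio 1))
    simpa using this
  refine tendsto_nhds_unique ((hp.mul hK).congr' ?_) (tendsto_besselIntegral_order hw)
  filter_upwards [Ioo_mem_nhdsLT zero_lt_one] with a ha
  exact besselKQuotient_two_sqrt ha.1 ha.2 hw hw0

/-! ### The closed form as an integral -/

lemma norm_besselIntegral_one_le {w : ℂ} (hw : 0 ≤ w.re) : ‖besselIntegral 1 w‖ ≤ 1 := by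
  have h := norm_integral_le_of_norm_le (μ := volume.restrict (Set.Ioi (0 : ℝ)))
    (f := fun t : ℝ => ((t ^ ((1 : ℝ) - 1) : ℝ) : ℂ) * Complex.exp (-(t + w / t)))
    (g := fun t => Real.exp (-t)) (integrableOn_exp_neg_Ioi 0) (by
      filter_upwards [ae_restrict_mem measurableSet_Ioi] with t ht
      simpa using norm_besselIntegrand_le 1 hw ht)
  rwa [integral_exp_neg_Ioi_zero] at h

/-- Continuity up to the imaginary axis, including 0, is what permits k → 0⁻ and C → 0⁺. -/
lemma continuousOn_besselIntegral_one : ContinuousOn (besselIntegral 1) {w | 0 ≤ w.re} := by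
  refine continuousOn_of_dominated (bound := fun t => Real.exp (-t))
    (fun w _ => (measurable_besselIntegrand 1 w).aestronglyMeasurable) (fun w hw => ?_)
    (integrableOn_exp_neg_Ioi 0) (Eventually.of_forall fun t => Continuous.continuousOn ?_)
  · filter_upwards [ae_restrict_mem measurableSet_Ioi] with t ht
    simpa using norm_besselIntegrand_le 1 hw ht
  · fun_prop

lemma besselIntegral_one_zero : besselIntegral 1 0 = 1 := by
  have h : besselIntegral 1 0 = ∫ t in Set.Ioi (0 : ℝ), ((Real.exp (-t) : ℝ) : ℂ) := by
    refine setIntegral_congr_fun measurableSet_Ioi fun t _ => ?_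
    simp
  rw [h, integral_complex_ofReal, integral_exp_neg_Ioi_zero, Complex.ofReal_one]

/-- The complex number `-(k + 2πi|ξ|)` occurring in the closed form. -/
noncomputable def dampedFrequency (k : ℝ) (ξ : Space3) : ℂ :=
  -((k : ℂ) + 2 * Real.pi * Complex.I * ‖ξ‖)

lemma dampedFrequency_re (k : ℝ) (ξ : Space3) : (dampedFrequency k ξ).re = -k := by
  simp [dampedFrequency]

lemma dampedFrequency_im (k : ℝ) (ξ : Space3) :
    (dampedFrequency k ξ).im = -(2 * Real.pi * ‖ξ‖) := by
  simp [dampedFrequency]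

lemma le_norm_dampedFrequency (k : ℝ) (ξ : Space3) :
    2 * Real.pi * ‖ξ‖ ≤ ‖dampedFrequency k ξ‖ := by
  refine le_trans ?_ (Complex.abs_im_le_norm _)
  rw [dampedFrequency_im, abs_neg]
  exact le_abs_self _

lemma dampedFrequency_ne_zero (k : ℝ) {ξ : Space3} (hξ : ξ ≠ 0) : dampedFrequency k ξ ≠ 0 := by
  have h1 := le_norm_dampedFrequency k ξ
  have h2 : 0 < ‖ξ‖ := norm_pos_iff.2 hξ
  exact norm_pos_iff.1 (lt_of_lt_of_le (by positivity) h1)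

lemma ofReal_mul_dampedFrequency_re_nonneg {C k : ℝ} (hC : 0 ≤ C) (hk : k ≤ 0) (ξ : Space3) :
    0 ≤ ((C : ℂ) * dampedFrequency k ξ).re := by
  rw [Complex.re_ofReal_mul, dampedFrequency_re]
  exact mul_nonneg hC (by linarith)

/-- A positive real factor only adds ± log C to the principal logarithm; these terms cancel and the
two halves of log a add up. -/
lemma sqrt_mul_sqrt_div {C : ℝ} (hC : 0 < C) {a : ℂ} (ha : a ≠ 0) :
    Complex.sqrt (C * a) * Complex.sqrt (a / C) = a := by
  have hC' : (C : ℂ) ≠ 0 := by exact_mod_cast hC.ne'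
  have h1 : a / C = ((C⁻¹ : ℝ) : ℂ) * a := by
    push_cast
    field_simp
  have hi : ((C⁻¹ : ℝ) : ℂ) ≠ 0 := by exact_mod_cast (inv_pos.2 hC).ne'
  rw [h1, Complex.sqrt, Complex.sqrt, Complex.cpow_def_of_ne_zero (mul_ne_zero hC' ha),
    Complex.cpow_def_of_ne_zero (mul_ne_zero hi ha), Complex.log_ofReal_mul hC ha,
    Complex.log_ofReal_mul (inv_pos.2 hC) ha, ← Complex.exp_add, Real.log_inv]
  conv_rhs => rw [← Complex.exp_log ha]
  congr 1
  push_cast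
  ring

lemma closedForm_eq_besselIntegral {C k : ℝ} (hC : 0 < C) (hk : k ≤ 0) {ξ : Space3} (hξ : ξ ≠ 0) :
    closedForm C k ξ =
      2 / ‖ξ‖ * (besselIntegral 1 (C * dampedFrequency k ξ) / dampedFrequency k ξ).im := by
  have ha := dampedFrequency_ne_zero k hξ
  have hC' : (C : ℂ) ≠ 0 := by exact_mod_cast hC.ne'
  have hs := sqrt_mul_sqrt_div hC ha
  have hs2 : Complex.sqrt (dampedFrequency k ξ / C) ≠ 0 := fun h => by
    rw [h, mul_zero] at hs
    exact ha hs.symm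
  rw [← two_mul_sqrt_mul_besselK1 (ofReal_mul_dampedFrequency_re_nonneg hC.le hk ξ)
    (mul_ne_zero hC' ha), closedForm, neg_mul, ← mul_neg]
  change 2 / ‖ξ‖ * (2 * besselK1 (2 * Complex.sqrt (C * dampedFrequency k ξ)) /
    Complex.sqrt (dampedFrequency k ξ / C)).im = _
  congr 2
  rw [div_eq_div_iff hs2 ha]
  linear_combination -2 * besselK1 (2 * Complex.sqrt (C * dampedFrequency k ξ)) * hs

/-- From |J| ≤ 1 and |a| ≥ 2π|ξ|. The bound is independent of C and k, and equals the Coulomb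
transform itself. -/
lemma abs_closedForm_le {C k : ℝ} (hC : 0 < C) (hk : k ≤ 0) {ξ : Space3} (hξ : ξ ≠ 0) :
    |closedForm C k ξ| ≤ 1 / (Real.pi * ‖ξ‖ ^ 2) := by
  have hn : 0 < ‖ξ‖ := norm_pos_iff.2 hξ
  rw [closedForm_eq_besselIntegral hC hk hξ, abs_mul, abs_of_pos (by positivity)]
  calc _ ≤ 2 / ‖ξ‖ * (1 / (2 * Real.pi * ‖ξ‖)) := by
        gcongr
        refine (Complex.abs_im_le_norm _).trans ?_
        rw [norm_div]
        gcongr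
        · exact norm_besselIntegral_one_le (ofReal_mul_dampedFrequency_re_nonneg hC.le hk ξ)
        · exact le_norm_dampedFrequency k ξ
    _ = _ := by field_simp

lemma measurable_closedForm {C k : ℝ} (hC : 0 < C) (hk : k ≤ 0) : Measurable (closedForm C k) := by
  refine measurable_of_continuousOn_compl_singleton 0 ?_
  have hd : Continuous (dampedFrequency k) := by
    unfold dampedFrequency
    fun_prop
  have h1 : ContinuousOn (fun ξ : Space3 => 2 / ‖ξ‖ *
      (besselIntegral 1 (C * dampedFrequency k ξ) / dampedFrequency k ξ).im) {0}ᶜ := by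
    have hB : Continuous fun ξ : Space3 => besselIntegral 1 (C * dampedFrequency k ξ) :=
      continuousOn_besselIntegral_one.comp_continuous (by fun_prop)
        fun ξ => ofReal_mul_dampedFrequency_re_nonneg hC.le hk ξ
    refine (continuousOn_const.div continuous_norm.continuousOn
      fun ξ hξ => norm_ne_zero_iff.2 hξ).mul (Complex.continuous_im.comp_continuousOn ?_)
    exact hB.continuousOn.div hd.continuousOn fun ξ hξ => dampedFrequency_ne_zero k hξ
  exact h1.congr fun ξ hξ => closedForm_eq_besselIntegral hC hk hξ

lemma tendsto_closedForm_damping {C : ℝ} (hC : 0 < C) {ξ : Space3} (hξ : ξ ≠ 0) :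
    Tendsto (fun k : ℝ => closedForm C k ξ) (𝓝[<] 0) (𝓝 (closedForm C 0 ξ)) := by
  have hd : Continuous fun k : ℝ => dampedFrequency k ξ := by
    unfold dampedFrequency
    fun_prop
  have hB : ContinuousOn (fun k : ℝ => besselIntegral 1 (C * dampedFrequency k ξ)) (Set.Iic 0) :=
    continuousOn_besselIntegral_one.comp (Continuous.continuousOn (by fun_prop))
      fun k hk => ofReal_mul_dampedFrequency_re_nonneg hC.le hk ξ
  have h1 : ContinuousOn (fun k : ℝ => closedForm C k ξ) (Set.Iic 0) :=
    (continuousOn_const.mul (Complex.continuous_im.comp_continuousOn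
      (hB.div hd.continuousOn fun k _ => dampedFrequency_ne_zero k hξ))).congr
      fun k hk => closedForm_eq_besselIntegral hC hk hξ
  exact (h1 0 Set.self_mem_Iic).mono_left (nhdsWithin_mono _ Set.Iio_subset_Iic_self)

lemma two_div_mul_inv_dampedFrequency_im {ξ : Space3} (hξ : ξ ≠ 0) :
    2 / ‖ξ‖ * (1 / dampedFrequency 0 ξ).im = 1 / (Real.pi * ‖ξ‖ ^ 2) := by
  have hn : ‖ξ‖ ≠ 0 := norm_ne_zero_iff.2 hξ
  rw [one_div, Complex.inv_im, Complex.normSq_apply, dampedFrequency_re, dampedFrequency_im]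
  field_simp
  ring

lemma tendsto_closedForm_coulomb {ξ : Space3} (hξ : ξ ≠ 0) :
    Tendsto (fun C : ℝ => closedForm C 0 ξ) (𝓝[>] 0) (𝓝 (1 / (Real.pi * ‖ξ‖ ^ 2))) := by
  have hB : ContinuousOn (fun C : ℝ => 2 / ‖ξ‖ *
      (besselIntegral 1 (C * dampedFrequency 0 ξ) / dampedFrequency 0 ξ).im) (Set.Ici 0) := by
    refine continuousOn_const.mul (Complex.continuous_im.comp_continuousOn
      (ContinuousOn.div_const ?_ _))
    exact continuousOn_besselIntegral_one.comp (Continuous.continuousOn (by fun_prop))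
      fun C hC => ofReal_mul_dampedFrequency_re_nonneg hC le_rfl ξ
  have h1 := (hB 0 Set.self_mem_Ici).mono_left (nhdsWithin_mono _ Set.Ioi_subset_Ici_self)
  simp only [Complex.ofReal_zero, zero_mul, besselIntegral_one_zero,
    two_div_mul_inv_dampedFrequency_im hξ] at h1
  refine h1.congr' ?_
  filter_upwards [self_mem_nhdsWithin] with C hC
  exact (closedForm_eq_besselIntegral hC le_rfl hξ).symm

lemma norm_cexp_neg_div_add_mul (C : ℝ) (a : ℂ) (r : ℝ) :
    ‖Complex.exp (-(C / r)) * Complex.exp (-(a * r))‖ =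
      Real.exp (-(C / r)) * Real.exp (-(a.re * r)) := by
  rw [norm_mul, norm_exp_neg_mul_ofReal, Complex.norm_exp]
  simp [← Complex.ofReal_div]

/-- The Laplace transform of `e^{-C/r}`. -/
lemma integral_exp_neg_div_mul_exp_neg {C : ℝ} (hC : 0 < C) {a : ℂ} (ha : 0 < a.re) :
    ∫ r in Set.Ioi (0 : ℝ), Complex.exp (-(C / r)) * Complex.exp (-(a * r)) =
      besselIntegral 1 (C * a) / a := by
  have ha0 : a ≠ 0 := by
    rintro rfl
    simp at ha
  have himg : (fun r : ℝ => C / r) '' Set.Ioi 0 = Set.Ioi 0 := by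
    ext t
    constructor
    · rintro ⟨r, hr, rfl⟩
      exact div_pos hC hr
    · intro ht
      exact ⟨C / t, div_pos hC ht, by
        have : t ≠ 0 := ne_of_gt ht
        field_simp⟩
  have hder : ∀ r ∈ Set.Ioi (0 : ℝ),
      HasDerivWithinAt (fun r : ℝ => C / r) (-(C / r ^ 2)) (Set.Ioi 0) r := fun r hr => by
    have := ((hasDerivAt_inv (ne_of_gt hr)).const_mul C).hasDerivWithinAt (s := Set.Ioi 0)
    convert! this using 1
    rw [mul_neg, div_eq_mul_inv]
  have hinj : Set.InjOn (fun r : ℝ => C / r) (Set.Ioi 0) := fun r hr s hs h => by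
    have hr' : r ≠ 0 := ne_of_gt hr
    have hs' : s ≠ 0 := ne_of_gt hs
    have h' : C / r = C / s := h
    rw [div_eq_div_iff hr' hs'] at h'
    exact (mul_left_cancel₀ hC.ne' h').symm
  have hcongr : ∀ r ∈ Set.Ioi (0 : ℝ), |(-(C / r ^ 2))| •
      ((((C / r) ^ ((1 : ℝ) - 1) : ℝ) : ℂ) *
        Complex.exp (-(((C / r : ℝ) : ℂ) + C * a / ((C / r : ℝ) : ℂ)))) =
      (C / r ^ 2 * Complex.exp (-(C / r))) * Complex.exp (-(a * r)) := fun r hr => by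
    have hr' : (r : ℂ) ≠ 0 := by exact_mod_cast (ne_of_gt hr : r ≠ 0)
    have hC' : (C : ℂ) ≠ 0 := by exact_mod_cast hC.ne'
    rw [abs_neg, abs_of_pos (by have : 0 < r := hr; positivity), sub_self, Real.rpow_zero,
      Complex.real_smul, mul_assoc, ← Complex.exp_add]
    push_cast
    rw [one_mul]
    congr 2
    field_simp
    ring
  have hint := integrableOn_besselIntegrand zero_lt_one
    (w := C * a) (by rw [Complex.re_ofReal_mul]; positivity)
  -- With t = C/r the integral becomes that of (d/dr e^{-C/r}) e^{-ar}, ready for integration by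
  -- parts.
  have hval : besselIntegral 1 (C * a) = ∫ r in Set.Ioi (0 : ℝ),
      (C / r ^ 2 * Complex.exp (-(C / r))) * Complex.exp (-(a * r)) := by
    rw [besselIntegral]
    nth_rewrite 1 [← himg]
    rw [integral_image_eq_integral_abs_deriv_smul measurableSet_Ioi hder hinj]
    exact setIntegral_congr_fun measurableSet_Ioi hcongr
  rw [← himg, integrableOn_image_iff_integrableOn_abs_deriv_smul measurableSet_Ioi hder hinj] at hint
  have hint' := hint.congr_fun hcongr measurableSet_Ioi
  have hbase : IntegrableOn
      (fun r : ℝ => Complex.exp (-(C / r)) * Complex.exp (-(a * r))) (Set.Ioi 0) := by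
    have h0 := integrableOn_rpow_mul_exp_neg (b := 0) (by norm_num) ha
    simp only [Real.rpow_zero, one_mul] at h0
    refine Integrable.mono' h0 (Measurable.aestronglyMeasurable (by fun_prop)) ?_
    filter_upwards [ae_restrict_mem measurableSet_Ioi] with r hr
    have hr' : (0 : ℝ) < r := hr
    rw [norm_cexp_neg_div_add_mul]
    exact mul_le_of_le_one_left (Real.exp_nonneg _)
      (Real.exp_le_one_iff.2 (by have : 0 < C / r := by positivity
                                 linarith))
  -- Both boundary terms vanish: e^{-C/r} decays at 0 and e^{-ar} at infinity.
  have key := integral_Ioi_mul_deriv_eq_deriv_mul (a := 0) (a' := (0 : ℂ)) (b' := (0 : ℂ))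
    (u := fun r : ℝ => Complex.exp (-(C / r)))
    (u' := fun r : ℝ => C / r ^ 2 * Complex.exp (-(C / r)))
    (v := fun r : ℝ => Complex.exp (-(a * r))) (v' := fun r : ℝ => -a * Complex.exp (-(a * r)))
    ?_ ?_ ?_ hint' ?_ ?_
  · rw [hval, eq_div_iff ha0]
    have h2 : ∫ r in Set.Ioi (0 : ℝ), Complex.exp (-(C / r)) * (-a * Complex.exp (-(a * r))) =
        -a * ∫ r in Set.Ioi (0 : ℝ), Complex.exp (-(C / r)) * Complex.exp (-(a * r)) := by
      rw [← integral_const_mul]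
      congr 1
      ext r
      ring
    rw [h2] at key
    linear_combination -key
  · intro r hr
    have hr0 : r ≠ 0 := ne_of_gt hr
    have h1 := (((hasDerivAt_inv hr0).const_mul C).ofReal_comp).fun_neg.cexp
    convert! h1 using 1
    · ext s
      push_cast
      rw [div_eq_mul_inv]
    · push_cast
      rw [div_eq_mul_inv, div_eq_mul_inv]
      ring
  · intro r _
    have h1 : HasDerivAt (fun r : ℝ => -(a * (r : ℂ))) (-a) r := by
      simpa using ((Complex.ofRealCLM.hasDerivAt (x := r)).const_mul a).fun_neg
    convert! h1.cexp using 1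
    ring
  · refine IntegrableOn.congr_fun (hbase.const_mul (-a)) (fun r _ => ?_) measurableSet_Ioi
    simp only [Pi.mul_apply]
    ring
  · have h1 : Tendsto (fun r : ℝ => Real.exp (-(C / r))) (𝓝[>] 0) (𝓝 0) := by
      have h0 : Tendsto (fun r : ℝ => C / r) (𝓝[>] 0) atTop := by
        simp only [div_eq_mul_inv]
        exact tendsto_inv_nhdsGT_zero.const_mul_atTop hC
      exact Real.tendsto_exp_neg_atTop_nhds_zero.comp h0
    refine squeeze_zero_norm' ?_ h1
    filter_upwards [self_mem_nhdsWithin] with r hr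
    have hr' : (0 : ℝ) < r := hr
    rw [Pi.mul_apply, norm_cexp_neg_div_add_mul]
    exact mul_le_of_le_one_right (Real.exp_nonneg _)
      (Real.exp_le_one_iff.2 (by have : 0 < a.re * r := by positivity
                                 linarith))
  · have h1 : Tendsto (fun r : ℝ => Real.exp (-(a.re * r))) atTop (𝓝 0) :=
      Real.tendsto_exp_neg_atTop_nhds_zero.comp (tendsto_id.const_mul_atTop ha)
    refine squeeze_zero_norm' ?_ h1
    filter_upwards [eventually_gt_atTop 0] with r hr
    rw [Pi.mul_apply, norm_cexp_neg_div_add_mul]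
    exact mul_le_of_le_one_left (Real.exp_nonneg _)
      (Real.exp_le_one_iff.2 (by have : 0 < C / r := by positivity
                                 linarith))

/-! ### The Fourier transform of a radial function on `ℝ³` -/

/-- The splitting of `ℝ³` as the product of the first coordinate axis and the plane of the other two
coordinates. -/
noncomputable def space3Split : Space3 ≃ᵐ ℝ × EuclideanSpace ℝ (Fin 2) :=
  ((MeasurableEquiv.toLp 2 (Fin 3 → ℝ)).symm.trans
    (MeasurableEquiv.piFinSuccAbove (fun _ : Fin 3 => ℝ) 0)).trans
    ((MeasurableEquiv.refl ℝ).prodCongr (MeasurableEquiv.toLp 2 (Fin 2 → ℝ)))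

lemma measurePreserving_space3Split : MeasurePreserving space3Split := by
  refine MeasurePreserving.trans (MeasurePreserving.trans
    (EuclideanSpace.volume_preserving_symm_measurableEquiv_toLp (Fin 3))
    (volume_preserving_piFinSuccAbove (fun _ : Fin 3 => ℝ) 0)) ?_
  exact (MeasurePreserving.id volume).prod
    (EuclideanSpace.volume_preserving_symm_measurableEquiv_toLp (Fin 2)).symm

lemma space3Split_fst (x : Space3) : (space3Split x).1 = x 0 := rfl

lemma norm_space3Split (x : Space3) :
    ‖x‖ = √((space3Split x).1 ^ 2 + ‖(space3Split x).2‖ ^ 2) := by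
  have h : ‖(space3Split x).2‖ ^ 2 = x 1 ^ 2 + x 2 ^ 2 := by
    rw [EuclideanSpace.real_norm_sq_eq, Fin.sum_univ_two]
    rfl
  rw [EuclideanSpace.norm_eq, Fin.sum_univ_three, h, space3Split_fst]
  simp only [Real.norm_eq_abs, sq_abs]
  congr 1
  ring

/-- Substitution s = √(z² + r²), for which s ds = r dr. -/
lemma integral_Ioi_mul_comp_sqrt (z : ℝ) (h : ℝ → ℂ) :
    ∫ r in Set.Ioi (0 : ℝ), (r : ℂ) * h (√(z ^ 2 + r ^ 2)) =
      ∫ s in Set.Ioi |z|, (s : ℂ) * h s := by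
  have hpos : ∀ r ∈ Set.Ioi (0 : ℝ), 0 < z ^ 2 + r ^ 2 := fun r hr => by
    have : (0 : ℝ) < r := hr
    positivity
  have himg : (fun r : ℝ => √(z ^ 2 + r ^ 2)) '' Set.Ioi 0 = Set.Ioi |z| := by
    ext s
    constructor
    · rintro ⟨r, hr, rfl⟩
      have hr' : (0 : ℝ) < r := hr
      refine Real.lt_sqrt_of_sq_lt ?_
      rw [sq_abs]
      have : 0 < r ^ 2 := by positivity
      linarith
    · intro hs
      have hs' : |z| < s := hs
      have h0 : 0 < s := (abs_nonneg z).trans_lt hs'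
      have h1 : z ^ 2 < s ^ 2 := by
        rw [← sq_abs z]
        gcongr
      refine ⟨√(s ^ 2 - z ^ 2), Real.sqrt_pos.2 (by linarith), ?_⟩
      simp only
      rw [Real.sq_sqrt (by linarith), add_sub_cancel, Real.sqrt_sq h0.le]
  have hder : ∀ r ∈ Set.Ioi (0 : ℝ), HasDerivWithinAt (fun r : ℝ => √(z ^ 2 + r ^ 2))
      (r / √(z ^ 2 + r ^ 2)) (Set.Ioi 0) r := fun r hr => by
    have h1 : HasDerivAt (fun r : ℝ => z ^ 2 + r ^ 2) (2 * r) r := by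
      simpa using (hasDerivAt_pow 2 r).const_add (z ^ 2)
    convert! (h1.sqrt (hpos r hr).ne').hasDerivWithinAt using 1
    rw [mul_div_mul_left _ _ two_ne_zero]
  have hinj : Set.InjOn (fun r : ℝ => √(z ^ 2 + r ^ 2)) (Set.Ioi 0) := fun r hr s hs h => by
    have h1 := (Real.sqrt_inj (hpos r hr).le (hpos s hs).le).1 h
    exact (pow_left_inj₀ (le_of_lt hr) (le_of_lt hs) two_ne_zero).1 (add_left_cancel h1)
  rw [← himg, integral_image_eq_integral_abs_deriv_smul measurableSet_Ioi hder hinj]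
  refine setIntegral_congr_fun measurableSet_Ioi fun r hr => ?_
  have hr' : (0 : ℝ) < r := hr
  have hs : 0 < √(z ^ 2 + r ^ 2) := Real.sqrt_pos.2 (hpos r hr)
  rw [abs_of_pos (by positivity), Complex.real_smul, ← mul_assoc, ← Complex.ofReal_mul,
    div_mul_cancel₀ _ hs.ne']

lemma integral_plane_comp_norm (z : ℝ) (h : ℝ → ℂ) :
    ∫ y : EuclideanSpace ℝ (Fin 2), h (√(z ^ 2 + ‖y‖ ^ 2)) =
      2 * Real.pi * ∫ s in Set.Ioi |z|, (s : ℂ) * h s := by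
  have h1 := integral_fun_norm_addHaar (volume : Measure (EuclideanSpace ℝ (Fin 2)))
    (fun r => h (√(z ^ 2 + r ^ 2)))
  rw [h1, ← integral_Ioi_mul_comp_sqrt, Measure.real, EuclideanSpace.volume_ball_fin_two,
    finrank_euclideanSpace_fin]
  simp [Real.pi_pos.le, mul_assoc]

lemma integral_cexp_symmetric {ρ : ℝ} (hρ : ρ ≠ 0) (s : ℝ) :
    ∫ z in (-s)..s, Complex.exp (((-2 * Real.pi * (z * ρ) : ℝ) : ℂ) * Complex.I) =
      ((Real.sin (2 * Real.pi * ρ * s) / (Real.pi * ρ) : ℝ) : ℂ) := by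
  have hc : -2 * (Real.pi : ℂ) * ρ * Complex.I ≠ 0 := by
    have h1 : (ρ : ℂ) ≠ 0 := by exact_mod_cast hρ
    have h2 : (Real.pi : ℂ) ≠ 0 := by exact_mod_cast Real.pi_ne_zero
    simp [h1, h2]
  have h1 : ∀ z : ℝ, Complex.exp (((-2 * Real.pi * (z * ρ) : ℝ) : ℂ) * Complex.I) =
      Complex.exp (-2 * (Real.pi : ℂ) * ρ * Complex.I * z) := fun z => by
    push_cast
    congr 1
    ring
  simp only [h1]
  rw [integral_exp_mul_complex hc]
  push_cast
  rw [Complex.sin]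
  have h1 : (ρ : ℂ) ≠ 0 := by exact_mod_cast hρ
  have h2 : (Real.pi : ℂ) ≠ 0 := by exact_mod_cast Real.pi_ne_zero
  field_simp
  ring_nf
  simp only [Complex.I_sq]
  ring

/-- The reflection in the hyperplane orthogonal to the difference of two vectors of equal norm
exchanges them. -/
lemma exists_isometry_map_eq_single (ξ : Space3) :
    ∃ A : Space3 ≃ₗᵢ[ℝ] Space3, A ξ = EuclideanSpace.single 0 ‖ξ‖ :=
  ⟨_, Submodule.reflection_sub (by simp)⟩

/-- The Fourier transform of the radial function `g(|x|)/|x|` on `ℝ³`. -/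
theorem fourier_radial {g : ℝ → ℝ} (hg : Measurable g)
    (hint : IntegrableOn (fun s => s * g s) (Set.Ioi 0))
    (hf : Integrable fun x : Space3 => g ‖x‖ / ‖x‖) {ξ : Space3} (hξ : ξ ≠ 0) :
    𝓕 (fun x : Space3 => ((g ‖x‖ / ‖x‖ : ℝ) : ℂ)) ξ =
      ((2 / ‖ξ‖ * ∫ s in Set.Ioi (0 : ℝ), g s * Real.sin (2 * Real.pi * ‖ξ‖ * s) : ℝ) : ℂ) := by
  have hρ : ‖ξ‖ ≠ 0 := norm_ne_zero_iff.2 hξ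
  obtain ⟨A, hA⟩ := exists_isometry_map_eq_single ξ
  have hrot := Real.fourier_comp_linearIsometry A
    (fun x : Space3 => ((g ‖x‖ / ‖x‖ : ℝ) : ℂ)) ξ
  have hcomp : (fun x : Space3 => ((g ‖x‖ / ‖x‖ : ℝ) : ℂ)) ∘ A =
      fun x : Space3 => ((g ‖x‖ / ‖x‖ : ℝ) : ℂ) := by
    ext x
    simp
  rw [hcomp, hA] at hrot
  rw [hrot, Real.fourier_eq']
  set ρ := ‖ξ‖ with hρdef
  set E : ℝ → ℂ := fun z => Complex.exp (((-2 * Real.pi * (z * ρ) : ℝ) : ℂ) * Complex.I) with hE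
  have hEm : Measurable E := by fun_prop
  have hE1 : ∀ z, ‖E z‖ = 1 := fun z => Complex.norm_exp_ofReal_mul_I _
  let h : ℝ → ℂ := fun s => ((g s / s : ℝ) : ℂ)
  have hhm : Measurable h := by fun_prop
  let Φ : ℝ × EuclideanSpace ℝ (Fin 2) → ℂ := fun p => E p.1 * h (√(p.1 ^ 2 + ‖p.2‖ ^ 2))
  have hΦ : ∀ x : Space3, Φ (space3Split x) =
      Complex.exp (((-2 * Real.pi * inner ℝ x (EuclideanSpace.single 0 ρ : Space3) : ℝ) : ℂ) *
        Complex.I) • ((g ‖x‖ / ‖x‖ : ℝ) : ℂ) := fun x => by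
    have h1 : inner ℝ x (EuclideanSpace.single 0 ρ : Space3) = x 0 * ρ := by
      rw [EuclideanSpace.inner_single_right]
      simp [mul_comm]
    rw [h1, norm_space3Split x]
    rfl
  have hΦint : Integrable Φ := by
    rw [← measurePreserving_space3Split.integrable_comp_emb space3Split.measurableEmbedding]
    have h1 : Integrable fun x : Space3 => ((g ‖x‖ / ‖x‖ : ℝ) : ℂ) := hf.ofReal
    refine h1.mono (Measurable.aestronglyMeasurable
      (Measurable.comp (by fun_prop) space3Split.measurable)) (Eventually.of_forall fun x => ?_)
    rw [Function.comp_apply, hΦ, norm_smul, Complex.norm_exp_ofReal_mul_I, one_mul]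
  simp only [← hΦ]
  rw [measurePreserving_space3Split.integral_comp space3Split.measurableEmbedding]
  rw [Measure.volume_eq_prod] at hΦint ⊢
  rw [integral_prod _ hΦint]
  -- Integrating over the plane at height z gives the weight s ds on s > |z|, which cancels the
  -- factor 1/s. Writing |z| < s as an indicator in z prepares the exchange of integrals.
  have hinner : ∀ z : ℝ, ∫ y, Φ (z, y) =
      2 * Real.pi * ∫ s in Set.Ioi (0 : ℝ), (Set.Ioo (-s) s).indicator (fun z => E z * g s) z := by
    intro z
    simp only [Φ]
    rw [integral_const_mul, integral_plane_comp_norm, ← mul_assoc, mul_comm (E z), mul_assoc,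
      ← integral_const_mul]
    congr 1
    have hsub : Set.Ioi |z| ⊆ Set.Ioi 0 := Set.Ioi_subset_Ioi (abs_nonneg z)
    rw [← integral_indicator measurableSet_Ioi, ← integral_indicator measurableSet_Ioi]
    congr 1
    ext s
    by_cases hs : |z| < s
    · have h0 : 0 < s := (abs_nonneg z).trans_lt hs
      have h0' : (s : ℂ) ≠ 0 := by exact_mod_cast h0.ne'
      rw [Set.indicator_of_mem (show s ∈ Set.Ioi |z| from hs),
        Set.indicator_of_mem (show s ∈ Set.Ioi 0 from h0),
        Set.indicator_of_mem (show z ∈ Set.Ioo (-s) s from abs_lt.1 hs)]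
      simp only [h]
      push_cast
      field_simp
    · rw [Set.indicator_of_notMem (show s ∉ Set.Ioi |z| from hs)]
      by_cases h0 : 0 < s
      · rw [Set.indicator_of_mem (show s ∈ Set.Ioi 0 from h0),
          Set.indicator_of_notMem (fun hz : z ∈ Set.Ioo (-s) s => hs (abs_lt.2 hz))]
      · rw [Set.indicator_of_notMem (show s ∉ Set.Ioi 0 from h0)]
  simp only [hinner]
  rw [integral_const_mul]
  have hswapm : Measurable
      (fun p : ℝ × ℝ => (Set.Ioo (-p.2) p.2).indicator (fun z => E z * g p.2) p.1) := by
    have : (fun p : ℝ × ℝ => (Set.Ioo (-p.2) p.2).indicator (fun z => E z * g p.2) p.1) =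
        {p : ℝ × ℝ | -p.2 < p.1 ∧ p.1 < p.2}.indicator fun p => E p.1 * g p.2 := by
      ext p
      simp [Set.indicator_apply]
    rw [this]
    refine Measurable.indicator (by fun_prop) ?_
    exact (measurableSet_lt measurable_snd.neg measurable_fst).inter
      (measurableSet_lt measurable_fst measurable_snd)
  have hswap : Integrable
      (fun p : ℝ × ℝ => (Set.Ioo (-p.2) p.2).indicator (fun z => E z * g p.2) p.1)
      ((volume : Measure ℝ).prod (volume.restrict (Set.Ioi 0))) := by
    rw [integrable_prod_iff' hswapm.aestronglyMeasurable]
    constructor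
    · refine Eventually.of_forall fun s => ?_
      refine (integrable_indicator_iff (f := fun z => E z * g s)
        (measurableSet_Ioo (a := -s) (b := s))).2 ?_
      refine Measure.integrableOn_of_bounded (M := |g s|) (by simp)
        (Measurable.aestronglyMeasurable (by fun_prop)) (Eventually.of_forall fun z => ?_)
      rw [norm_mul, hE1, one_mul, Complex.norm_real, Real.norm_eq_abs]
    -- The z-integral of the absolute value is 2s|g(s)|, which is why s·g(s) has to be integrable.
    · refine (hint.norm.const_mul 2).congr ?_
      filter_upwards [ae_restrict_mem measurableSet_Ioi] with s hs
      have hs' : (0 : ℝ) < s := hs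
      have h1 : ∀ z : ℝ, ‖(Set.Ioo (-s) s).indicator (fun z => E z * g s) z‖ =
          (Set.Ioo (-s) s).indicator (fun _ => |g s|) z := fun z => by
        rw [norm_indicator_eq_indicator_norm]
        congr 1
        ext z
        rw [norm_mul, hE1, one_mul, Complex.norm_real, Real.norm_eq_abs]
      simp only [h1]
      rw [integral_indicator measurableSet_Ioo, setIntegral_const, Measure.real, Real.volume_Ioo,
        ENNReal.toReal_ofReal (by linarith), norm_mul, Real.norm_of_nonneg hs'.le,
        Real.norm_eq_abs, smul_eq_mul]
      ring
  rw [integral_integral_swap hswap]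
  have hfin : ∀ s ∈ Set.Ioi (0 : ℝ),
      ∫ z, (Set.Ioo (-s) s).indicator (fun z => E z * g s) z =
      ((1 / (Real.pi * ρ) * (g s * Real.sin (2 * Real.pi * ρ * s)) : ℝ) : ℂ) := by
    intro s hs
    have hs' : (0 : ℝ) < s := hs
    rw [integral_indicator measurableSet_Ioo, ← integral_Ioc_eq_integral_Ioo,
      ← intervalIntegral.integral_of_le (by linarith), intervalIntegral.integral_mul_const,
      integral_cexp_symmetric hρ]
    push_cast
    ring
  rw [setIntegral_congr_fun measurableSet_Ioi hfin, integral_complex_ofReal, integral_const_mul]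
  have hπ : (Real.pi : ℂ) ≠ 0 := by exact_mod_cast Real.pi_ne_zero
  have hρ' : (ρ : ℂ) ≠ 0 := by exact_mod_cast hρ
  push_cast
  field_simp

/-! ### The damped potential -/

lemma measurable_softPotential (C : ℝ) : Measurable (softPotential C) := by
  unfold softPotential
  fun_prop

lemma measurable_dampedPotential (C k : ℝ) : Measurable (dampedPotential C k) := by
  unfold dampedPotential
  exact (measurable_softPotential C).mul (by fun_prop)

lemma softPotential_nonneg (C : ℝ) (x : Space3) : 0 ≤ softPotential C x := by
  unfold softPotential
  positivity

lemma softPotential_le_coulomb {C : ℝ} (hC : 0 ≤ C) (x : Space3) :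
    softPotential C x ≤ coulombPotential x := by
  unfold softPotential coulombPotential
  gcongr
  exact Real.exp_le_one_iff.2 (div_nonpos_of_nonpos_of_nonneg (by linarith) (norm_nonneg x))

lemma dampedPotential_nonneg (C k : ℝ) (x : Space3) : 0 ≤ dampedPotential C k x :=
  mul_nonneg (softPotential_nonneg C x) (Real.exp_nonneg _)

lemma dampedPotential_le_soft (C : ℝ) {k : ℝ} (hk : k ≤ 0) (x : Space3) :
    dampedPotential C k x ≤ softPotential C x :=
  mul_le_of_le_one_right (softPotential_nonneg C x)
    (Real.exp_le_one_iff.2 (mul_nonpos_of_nonpos_of_nonneg hk (norm_nonneg x)))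

/-- In polar coordinates the density is r e^{-C/r}, which exceeds the constant e^{-C} for r > 1. -/
lemma not_integrable_softPotential {C : ℝ} (hC : 0 < C) : ¬ Integrable (softPotential C) := by
  intro h
  have h1 := (integrable_fun_norm_addHaar (volume : Measure Space3)
    (f := fun r => Real.exp (-C / r) / r)).1 h
  rw [finrank_euclideanSpace_fin] at h1
  have h2 : IntegrableOn (fun _ : ℝ => Real.exp (-C)) (Set.Ioi 1) := by
    refine Integrable.mono (h1.mono_set (Set.Ioi_subset_Ioi zero_le_one)) aestronglyMeasurable_const
      ?_
    filter_upwards [ae_restrict_mem measurableSet_Ioi] with r hr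
    have hr1 : (1 : ℝ) < r := hr
    have hr0 : 0 < r := by linarith
    simp only [Nat.add_one_sub_one, smul_eq_mul]
    rw [Real.norm_of_nonneg (Real.exp_nonneg _), Real.norm_of_nonneg (by positivity),
      show r ^ 2 * (Real.exp (-C / r) / r) = r * Real.exp (-C / r) by field_simp]
    have h3 : Real.exp (-C) ≤ Real.exp (-C / r) := by
      rw [Real.exp_le_exp, le_div_iff₀ hr0]
      nlinarith
    nlinarith [Real.exp_pos (-C)]
  rw [integrableOn_const_iff] at h2
  simp at h2

lemma integrableOn_mul_exp_damped {C k : ℝ} (hC : 0 < C) (hk : k < 0) :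
    IntegrableOn (fun s : ℝ => s * (Real.exp (-C / s) * Real.exp (k * s))) (Set.Ioi 0) := by
  have h0 := integrableOn_rpow_mul_exp_neg (b := 1) (r := -k) (by norm_num) (by linarith)
  refine Integrable.mono' h0 (Measurable.aestronglyMeasurable (by fun_prop)) ?_
  filter_upwards [ae_restrict_mem measurableSet_Ioi] with s hs
  have hs' : (0 : ℝ) < s := hs
  rw [Real.norm_of_nonneg (by positivity), Real.rpow_one, show -(-k * s) = k * s by ring]
  gcongr
  refine mul_le_of_le_one_left (Real.exp_nonneg _) (Real.exp_le_one_iff.2 ?_)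
  exact div_nonpos_of_nonpos_of_nonneg (by linarith) hs'.le

lemma integrable_dampedPotential {C k : ℝ} (hC : 0 < C) (hk : k < 0) :
    Integrable (dampedPotential C k) := by
  refine (integrable_fun_norm_addHaar (volume : Measure Space3)
    (f := fun r => Real.exp (-C / r) / r * Real.exp (k * r))).2 ?_
  rw [finrank_euclideanSpace_fin]
  refine (integrableOn_mul_exp_damped hC hk).congr_fun (fun s hs => ?_) measurableSet_Ioi
  have hs' : s ≠ 0 := ne_of_gt hs
  simp only [Nat.add_one_sub_one, smul_eq_mul]
  field_simp

/-- The sine transform of e^{-C/s+ks} is the imaginary part of the Laplace integral at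
`dampedFrequency k ξ`; its real part -k > 0 gives convergence. -/
theorem fourier_dampedPotential {C k : ℝ} (hC : 0 < C) (hk : k < 0) {ξ : Space3} (hξ : ξ ≠ 0) :
    𝓕 (fun x : Space3 => (dampedPotential C k x : ℂ)) ξ = (closedForm C k ξ : ℂ) := by
  have heq : dampedPotential C k =
      fun x : Space3 => Real.exp (-C / ‖x‖) * Real.exp (k * ‖x‖) / ‖x‖ := by
    ext x
    simp only [dampedPotential, softPotential]
    ring
  have hint := integrable_dampedPotential hC hk
  rw [heq] at hint ⊢
  rw [fourier_radial (g := fun s => Real.exp (-C / s) * Real.exp (k * s)) (by fun_prop)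
    (integrableOn_mul_exp_damped hC hk) hint hξ, closedForm_eq_besselIntegral hC hk.le hξ]
  have hre : 0 < (dampedFrequency k ξ).re := by
    rw [dampedFrequency_re]
    linarith
  rw [← integral_exp_neg_div_mul_exp_neg hC hre]
  congr 2
  have hI : IntegrableOn (fun r : ℝ => Complex.exp (-(C / r)) *
      Complex.exp (-(dampedFrequency k ξ * r))) (Set.Ioi 0) := by
    have h0 := integrableOn_rpow_mul_exp_neg (b := 0) (by norm_num) hre
    simp only [Real.rpow_zero, one_mul] at h0
    refine Integrable.mono' h0 (Measurable.aestronglyMeasurable (by fun_prop)) ?_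
    filter_upwards [ae_restrict_mem measurableSet_Ioi] with r hr
    have hr' : (0 : ℝ) < r := hr
    rw [norm_cexp_neg_div_add_mul]
    exact mul_le_of_le_one_left (Real.exp_nonneg _)
      (Real.exp_le_one_iff.2 (by have : 0 < C / r := by positivity
                                 linarith))
  have him := integral_im hI
  simp only [RCLike.im_to_complex] at him
  rw [← him]
  refine setIntegral_congr_fun measurableSet_Ioi fun r _ => ?_
  have e1 : Complex.exp (-(C / r)) = ((Real.exp (-C / r) : ℝ) : ℂ) := by
    push_cast
    rw [neg_div]
  have e2 : Complex.exp (-(dampedFrequency k ξ * r)) = ((Real.exp (k * r) : ℝ) : ℂ) *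
      Complex.exp ((2 * Real.pi * ‖ξ‖ * r : ℝ) * Complex.I) := by
    push_cast
    rw [← Complex.exp_add, dampedFrequency]
    congr 1
    ring
  simp only [e1, e2]
  rw [Complex.im_ofReal_mul, Complex.im_ofReal_mul, Complex.exp_ofReal_mul_I_im]
  ring

/-! ### Tempered distributions given by functions with a weak singularity -/

/-- The polar factor r² absorbs the singularity and leaves at most (1 + r)^{-2}. The case j = 1
serves the potentials, j = 2 their transforms. -/
lemma integrable_decay_mul_inv_norm_pow {j : ℕ} (hj : j = 1 ∨ j = 2) :
    Integrable fun x : Space3 => ((1 + ‖x‖) ^ 4)⁻¹ * (‖x‖ ^ j)⁻¹ := by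
  refine (integrable_fun_norm_addHaar (volume : Measure Space3)
    (f := fun r => ((1 + r) ^ 4)⁻¹ * (r ^ j)⁻¹)).2 ?_
  rw [finrank_euclideanSpace_fin]
  have h0 : Integrable fun x : ℝ => (1 + ‖x‖) ^ (-((2 : ℕ) : ℝ)) := integrable_one_add_norm (by simp)
  refine Integrable.mono' h0.integrableOn (Measurable.aestronglyMeasurable (by fun_prop)) ?_
  filter_upwards [ae_restrict_mem measurableSet_Ioi] with r hr
  have hr' : (0 : ℝ) < r := hr
  simp only [Nat.add_one_sub_one, smul_eq_mul]
  rw [Real.norm_of_nonneg (by positivity), Real.norm_of_nonneg hr'.le,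
    Real.rpow_neg (by positivity), Real.rpow_natCast,
    show r ^ 2 * (((1 + r) ^ 4)⁻¹ * (r ^ j)⁻¹) = (r ^ 2 / r ^ j) / (1 + r) ^ 4 by field_simp,
    div_le_iff₀ (by positivity), show ((1 + r) ^ 2)⁻¹ * (1 + r) ^ 4 = (1 + r) ^ 2 by field_simp]
  rcases hj with rfl | rfl
  · rw [show r ^ 2 / r ^ 1 = r by field_simp]
    nlinarith
  · rw [div_self (by positivity)]
    nlinarith

lemma exists_schwartz_decay (φ : 𝓢(Space3, ℂ)) :
    ∃ c : ℝ, ∀ x, ‖φ x‖ ≤ c * ((1 + ‖x‖) ^ 4)⁻¹ := by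
  obtain ⟨c, h⟩ : ∃ c : ℝ, ∀ x, (1 + ‖x‖) ^ 4 * ‖iteratedFDeriv ℝ 0 φ x‖ ≤ c :=
    ⟨_, SchwartzMap.one_add_le_sup_seminorm_apply (𝕜 := ℝ) (m := (4, 0)) (k := 4) (n := 0)
    le_rfl le_rfl φ⟩
  refine ⟨c, fun x => ?_⟩
  have hx := h x
  rw [norm_iteratedFDeriv_zero, mul_comm] at hx
  rw [← div_eq_mul_inv]
  exact (le_div_iff₀ (by positivity)).2 hx

lemma integrable_schwartz_mul_inv_norm_pow (φ : 𝓢(Space3, ℂ)) {j : ℕ} (hj : j = 1 ∨ j = 2) :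
    Integrable fun x => ‖φ x‖ * (‖x‖ ^ j)⁻¹ := by
  obtain ⟨c, hc⟩ := exists_schwartz_decay φ
  refine ((integrable_decay_mul_inv_norm_pow hj).const_mul c).mono'
    (Measurable.aestronglyMeasurable (φ.continuous.measurable.norm.mul (by fun_prop))) ?_
  refine Eventually.of_forall fun x => ?_
  rw [Real.norm_of_nonneg (by positivity), ← mul_assoc]
  gcongr
  exact hc x

lemma integrable_schwartz_mul_coulomb (φ : 𝓢(Space3, ℂ)) :
    Integrable fun x => ‖φ x‖ * coulombPotential x := by
  simpa [coulombPotential] using integrable_schwartz_mul_inv_norm_pow φ (Or.inl rfl)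

lemma integrable_schwartz_mul_fourier_coulomb (φ : 𝓢(Space3, ℂ)) :
    Integrable fun x => ‖φ x‖ * (1 / (Real.pi * ‖x‖ ^ 2)) := by
  refine ((integrable_schwartz_mul_inv_norm_pow φ (Or.inr rfl)).const_mul Real.pi⁻¹).congr ?_
  refine Eventually.of_forall fun x => ?_
  simp only [one_div, mul_inv]
  ring

lemma integrable_schwartz_mul {f B : Space3 → ℝ} (hf : Measurable f) (φ : 𝓢(Space3, ℂ))
    (hB : Integrable fun x => ‖φ x‖ * B x) (hle : ∀ᵐ x, |f x| ≤ B x) :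
    Integrable fun x => φ x * (f x : ℂ) := by
  refine hB.mono' (Measurable.aestronglyMeasurable
    (φ.continuous.measurable.mul (Complex.measurable_ofReal.comp hf))) ?_
  filter_upwards [hle] with x hx
  rw [norm_mul, Complex.norm_real, Real.norm_eq_abs]
  gcongr

lemma tendsto_integral_schwartz_mul {l : Filter ℝ} [l.IsCountablyGenerated]
    {f : ℝ → Space3 → ℝ} {f₀ B : Space3 → ℝ} (φ : 𝓢(Space3, ℂ))
    (hf : ∀ᶠ i in l, Measurable (f i)) (hB : Integrable fun x => ‖φ x‖ * B x)
    (hle : ∀ᶠ i in l, ∀ᵐ x, |f i x| ≤ B x)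
    (hlim : ∀ᵐ x, Tendsto (fun i => f i x) l (𝓝 (f₀ x))) :
    Tendsto (fun i => ∫ x, φ x * (f i x : ℂ)) l (𝓝 (∫ x, φ x * (f₀ x : ℂ))) := by
  refine tendsto_integral_filter_of_dominated_convergence _ ?_ ?_ hB ?_
  · filter_upwards [hf] with i hi
    exact Measurable.aestronglyMeasurable
      (φ.continuous.measurable.mul (Complex.measurable_ofReal.comp hi))
  · filter_upwards [hle] with i hi
    filter_upwards [hi] with x hx
    rw [norm_mul, Complex.norm_real, Real.norm_eq_abs]
    gcongr
  · filter_upwards [hlim] with x hx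
    exact ((Complex.continuous_ofReal.tendsto _).comp hx).const_mul _

lemma IsGivenBy.tendsto {l : Filter ℝ} [l.IsCountablyGenerated] {T : ℝ → 𝓢'(Space3, ℂ)}
    {T₀ : 𝓢'(Space3, ℂ)} {f : ℝ → Space3 → ℝ} {f₀ B : Space3 → ℝ}
    (hT : ∀ᶠ i in l, IsGivenBy (T i) (f i)) (hT₀ : IsGivenBy T₀ f₀)
    (hf : ∀ᶠ i in l, Measurable (f i))
    (hB : ∀ φ : 𝓢(Space3, ℂ), Integrable fun x => ‖φ x‖ * B x)
    (hle : ∀ᶠ i in l, ∀ᵐ x, |f i x| ≤ B x)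
    (hlim : ∀ᵐ x, Tendsto (fun i => f i x) l (𝓝 (f₀ x))) :
    Tendsto T l (𝓝 T₀) := by
  rw [PointwiseConvergenceCLM.tendsto_iff_forall_tendsto]
  intro φ
  rw [(hT₀ φ).2]
  refine (tendsto_integral_schwartz_mul φ hf (hB φ) hle hlim).congr' ?_
  filter_upwards [hT] with i hi
  exact (hi φ).2.symm

/-- Identifies a limit already known to exist: dominated convergence computes it on each Schwartz
function. This reaches transforms of functions that are not integrable. -/
lemma IsGivenBy.of_tendsto {l : Filter ℝ} [l.NeBot] [l.IsCountablyGenerated]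
    {T : ℝ → 𝓢'(Space3, ℂ)} {T₀ : 𝓢'(Space3, ℂ)} {f : ℝ → Space3 → ℝ} {f₀ B : Space3 → ℝ}
    (hT : ∀ᶠ i in l, IsGivenBy (T i) (f i)) (hTlim : Tendsto T l (𝓝 T₀))
    (hf : ∀ᶠ i in l, Measurable (f i)) (hf₀ : Measurable f₀)
    (hB : ∀ φ : 𝓢(Space3, ℂ), Integrable fun x => ‖φ x‖ * B x)
    (hle : ∀ᶠ i in l, ∀ᵐ x, |f i x| ≤ B x) (hle₀ : ∀ᵐ x, |f₀ x| ≤ B x)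
    (hlim : ∀ᵐ x, Tendsto (fun i => f i x) l (𝓝 (f₀ x))) :
    IsGivenBy T₀ f₀ := by
  intro φ
  refine ⟨integrable_schwartz_mul hf₀ φ (hB φ) hle₀, ?_⟩
  have h1 := PointwiseConvergenceCLM.tendsto_iff_forall_tendsto.1 hTlim φ
  refine tendsto_nhds_unique h1 ((tendsto_integral_schwartz_mul φ hf (hB φ) hle hlim).congr' ?_)
  filter_upwards [hT] with i hi
  exact (hi φ).2.symm

lemma tendsto_fourier_distribution {l : Filter ℝ} {T : ℝ → 𝓢'(Space3, ℂ)} {T₀ : 𝓢'(Space3, ℂ)}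
    (h : Tendsto T l (𝓝 T₀)) : Tendsto (fun i => 𝓕 (T i)) l (𝓝 (𝓕 T₀)) := by
  rw [PointwiseConvergenceCLM.tendsto_iff_forall_tendsto] at h ⊢
  intro φ
  simpa only [TemperedDistribution.fourier_apply] using h (𝓕 φ)

lemma exists_isGivenBy {f : Space3 → ℝ} (hf : Measurable f) (h0 : ∀ x, 0 ≤ f x)
    (hle : ∀ x, f x ≤ coulombPotential x) : ∃ T : 𝓢'(Space3, ℂ), IsGivenBy T f := by
  have hm : Measurable fun x => ENNReal.ofReal (f x) := hf.ennreal_ofReal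
  have htop : ∀ᵐ x, ENNReal.ofReal (f x) < ⊤ := Eventually.of_forall fun x => ENNReal.ofReal_lt_top
  -- The distribution is integration against the measure with density f; f ≤ 1/|x| makes (1 +
  -- |x|)^{-4} integrable for it.
  have hgrowth : (volume.withDensity fun x => ENNReal.ofReal (f x)).HasTemperateGrowth := by
    refine ⟨⟨4, ?_⟩⟩
    rw [integrable_withDensity_iff_integrable_smul' hm htop]
    refine (integrable_decay_mul_inv_norm_pow (Or.inl rfl)).mono'
      (Measurable.aestronglyMeasurable (by fun_prop)) (Eventually.of_forall fun x => ?_)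
    have h1 : f x ≤ (‖x‖ ^ 1)⁻¹ := by simpa [coulombPotential] using hle x
    rw [ENNReal.toReal_ofReal (h0 x), Real.rpow_neg (by positivity), Real.rpow_natCast, smul_eq_mul,
      Real.norm_of_nonneg (mul_nonneg (h0 x) (by positivity)), mul_comm]
    gcongr
  refine ⟨(volume.withDensity fun x => ENNReal.ofReal (f x)).toTemperedDistribution, fun φ =>
    ⟨integrable_schwartz_mul hf φ (integrable_schwartz_mul_coulomb φ)
      (Eventually.of_forall fun x => by rw [abs_of_nonneg (h0 x)]; exact hle x), ?_⟩⟩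
  change ∫ x, φ x ∂(volume.withDensity fun x => ENNReal.ofReal (f x)) = _
  rw [integral_withDensity_eq_integral_toReal_smul hm htop]
  refine integral_congr_ae (Eventually.of_forall fun x => ?_)
  simp only [ENNReal.toReal_ofReal (h0 x)]
  rw [Complex.real_smul, mul_comm]

lemma ae_ne_zero_space3 : ∀ᵐ x : Space3, x ≠ 0 := by
  simp [ae_iff]

/-- For integrable f the Fourier transform moves from the test function to f by Fubini. -/
lemma IsGivenBy.fourier {T : 𝓢'(Space3, ℂ)} {f F : Space3 → ℝ} (hT : IsGivenBy T f)
    (hf : Integrable f) (hF : Measurable F)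
    (hle : ∀ᵐ ξ, |F ξ| ≤ 1 / (Real.pi * ‖ξ‖ ^ 2))
    (h : ∀ᵐ ξ, 𝓕 (fun x => (f x : ℂ)) ξ = (F ξ : ℂ)) : IsGivenBy (𝓕 T) F := by
  intro φ
  refine ⟨integrable_schwartz_mul hF φ (integrable_schwartz_mul_fourier_coulomb φ) hle, ?_⟩
  rw [TemperedDistribution.fourier_apply, (hT (𝓕 φ)).2]
  have h1 := VectorFourier.integral_fourierIntegral_smul_eq_flip (μ := (volume : Measure Space3))
    (ν := (volume : Measure Space3)) (L := innerₗ Space3) (f := φ) (g := fun x => (f x : ℂ))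
    Real.continuous_fourierChar continuous_inner φ.integrable hf.ofReal
  rw [flip_innerₗ] at h1
  refine h1.trans (integral_congr_ae ?_)
  filter_upwards [h] with ξ hξ
  rw [smul_eq_mul, ← hξ]
  rfl

/-! ### Pointwise limits of the potentials and the main theorem -/

lemma measurable_coulombPotential : Measurable coulombPotential := by
  unfold coulombPotential
  fun_prop

lemma tendsto_dampedPotential (C : ℝ) (x : Space3) :
    Tendsto (fun k : ℝ => dampedPotential C k x) (𝓝[<] 0) (𝓝 (softPotential C x)) := by
  have hc : Continuous fun k : ℝ => dampedPotential C k x := by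
    unfold dampedPotential
    fun_prop
  have := (hc.tendsto 0).mono_left (nhdsWithin_le_nhds (s := Set.Iio 0))
  simpa [dampedPotential] using this

lemma tendsto_softPotential (x : Space3) :
    Tendsto (fun C : ℝ => softPotential C x) (𝓝[>] 0) (𝓝 (coulombPotential x)) := by
  have hc : Continuous fun C : ℝ => softPotential C x := by
    unfold softPotential
    fun_prop
  have := (hc.tendsto 0).mono_left (nhdsWithin_le_nhds (s := Set.Ioi 0))
  simpa [softPotential, coulombPotential] using this

theorem mainTheorem3 :
    -- the limit that defines `K_1` exists away from the origin
    (∀ z : ℂ, z ≠ 0 → Tendsto (besselKQuotient z) (𝓝[≠] (1 : ℝ)) (𝓝 (besselK1 z))) ∧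
    -- `V_P` is not integrable
    (∀ C : ℝ, 0 < C → ¬ Integrable (softPotential C)) ∧
    -- the damped potentials are integrable; their classical Fourier transform and its limit
    (∀ C : ℝ, 0 < C →
      (∀ k : ℝ, k < 0 → Integrable (dampedPotential C k) ∧
        ∀ ξ : Space3, ξ ≠ 0 →
          𝓕 (fun x : Space3 => (dampedPotential C k x : ℂ)) ξ = (closedForm C k ξ : ℂ)) ∧
      (∀ ξ : Space3, ξ ≠ 0 →
        Tendsto (fun k : ℝ => 𝓕 (fun x : Space3 => (dampedPotential C k x : ℂ)) ξ)
          (𝓝[<] 0) (𝓝 (closedForm C 0 ξ : ℂ)))) ∧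
    -- pointwise limit of the closed form as `C → 0`
    (∀ ξ : Space3, ξ ≠ 0 →
      Tendsto (fun C : ℝ => closedForm C 0 ξ) (𝓝[>] 0) (𝓝 (1 / (Real.pi * ‖ξ‖ ^ 2)))) ∧
    -- the tempered distributions `V_P^k`, `V_P` and `1/|x|` and their Fourier transforms
    ∃ (Vd : ℝ → ℝ → 𝓢'(Space3, ℂ)) (V : ℝ → 𝓢'(Space3, ℂ)) (V₀ : 𝓢'(Space3, ℂ)),
      (∀ C : ℝ, 0 < C → ∀ k : ℝ, k < 0 → IsGivenBy (Vd C k) (dampedPotential C k)) ∧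
      (∀ C : ℝ, 0 < C → IsGivenBy (V C) (softPotential C)) ∧
      IsGivenBy V₀ coulombPotential ∧
      (∀ C : ℝ, 0 < C → ∀ k : ℝ, k < 0 → IsGivenBy (𝓕 (Vd C k)) (closedForm C k)) ∧
      (∀ C : ℝ, 0 < C → Tendsto (fun k : ℝ => Vd C k) (𝓝[<] 0) (𝓝 (V C))) ∧
      (∀ C : ℝ, 0 < C → Tendsto (fun k : ℝ => 𝓕 (Vd C k)) (𝓝[<] 0) (𝓝 (𝓕 (V C)))) ∧
      (∀ C : ℝ, 0 < C → IsGivenBy (𝓕 (V C)) (closedForm C 0)) ∧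
      Tendsto V (𝓝[>] 0) (𝓝 V₀) ∧
      Tendsto (fun C : ℝ => 𝓕 (V C)) (𝓝[>] 0) (𝓝 (𝓕 V₀)) ∧
      IsGivenBy (𝓕 V₀) (fun ξ => 1 / (Real.pi * ‖ξ‖ ^ 2)) := by
  -- Choice needs a distribution for all parameters; outside C > 0, k < 0 the value 0 is a filler.
  have hd : ∀ C k : ℝ, ∃ T : 𝓢'(Space3, ℂ), 0 < C → k < 0 → IsGivenBy T (dampedPotential C k) := by
    intro C k
    by_cases h : 0 < C ∧ k < 0
    · obtain ⟨T, hT⟩ := exists_isGivenBy (measurable_dampedPotential C k)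
        (dampedPotential_nonneg C k) fun x =>
          (dampedPotential_le_soft C h.2.le x).trans (softPotential_le_coulomb h.1.le x)
      exact ⟨T, fun _ _ => hT⟩
    · exact ⟨0, fun hC hk => absurd ⟨hC, hk⟩ h⟩
  have hs : ∀ C : ℝ, ∃ T : 𝓢'(Space3, ℂ), 0 < C → IsGivenBy T (softPotential C) := by
    intro C
    by_cases h : 0 < C
    · obtain ⟨T, hT⟩ := exists_isGivenBy (measurable_softPotential C) (softPotential_nonneg C)
        (softPotential_le_coulomb h.le)
      exact ⟨T, fun _ => hT⟩
    · exact ⟨0, fun hC => absurd hC h⟩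
  choose Vd hVd using hd
  choose V hV using hs
  obtain ⟨V₀, hV₀⟩ := exists_isGivenBy measurable_coulombPotential
    (fun x => by unfold coulombPotential; positivity) fun _ => le_rfl
  have hVdF : ∀ C : ℝ, 0 < C → ∀ k : ℝ, k < 0 → IsGivenBy (𝓕 (Vd C k)) (closedForm C k) :=
    fun C hC k hk => (hVd C k hC hk).fourier (integrable_dampedPotential hC hk)
      (measurable_closedForm hC hk.le)
      (ae_ne_zero_space3.mono fun ξ hξ => abs_closedForm_le hC hk.le hξ)
      (ae_ne_zero_space3.mono fun ξ hξ => fourier_dampedPotential hC hk hξ)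
  have hVdV : ∀ C : ℝ, 0 < C → Tendsto (fun k : ℝ => Vd C k) (𝓝[<] 0) (𝓝 (V C)) := fun C hC =>
    IsGivenBy.tendsto (f := dampedPotential C) (B := coulombPotential)
      (eventually_mem_nhdsWithin.mono fun k hk => hVd C k hC hk) (hV C hC)
      (Eventually.of_forall fun k => measurable_dampedPotential C k) integrable_schwartz_mul_coulomb
      (eventually_mem_nhdsWithin.mono fun k hk => Eventually.of_forall fun x => by
        rw [abs_of_nonneg (dampedPotential_nonneg C k x)]
        exact (dampedPotential_le_soft C (le_of_lt hk) x).trans (softPotential_le_coulomb hC.le x))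
      (Eventually.of_forall fun x => tendsto_dampedPotential C x)
  -- V_P is not integrable, so its transform is identified as the limit k → 0⁻ of those of V_P^k.
  have hVF : ∀ C : ℝ, 0 < C → IsGivenBy (𝓕 (V C)) (closedForm C 0) := fun C hC =>
    IsGivenBy.of_tendsto (l := 𝓝[<] (0 : ℝ)) (f := closedForm C)
      (eventually_mem_nhdsWithin.mono fun k hk => hVdF C hC k hk)
      (tendsto_fourier_distribution (hVdV C hC))
      (eventually_mem_nhdsWithin.mono fun k hk => measurable_closedForm hC (le_of_lt hk))
      (measurable_closedForm hC le_rfl) integrable_schwartz_mul_fourier_coulomb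
      (eventually_mem_nhdsWithin.mono fun k hk => ae_ne_zero_space3.mono fun ξ hξ =>
        abs_closedForm_le hC (le_of_lt hk) hξ)
      (ae_ne_zero_space3.mono fun ξ hξ => abs_closedForm_le hC le_rfl hξ)
      (ae_ne_zero_space3.mono fun ξ hξ => tendsto_closedForm_damping hC hξ)
  have hVV₀ : Tendsto V (𝓝[>] 0) (𝓝 V₀) :=
    IsGivenBy.tendsto (f := softPotential) (B := coulombPotential)
      (eventually_mem_nhdsWithin.mono fun C hC => hV C hC) hV₀
      (Eventually.of_forall measurable_softPotential) integrable_schwartz_mul_coulomb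
      (eventually_mem_nhdsWithin.mono fun C hC => Eventually.of_forall fun x => by
        rw [abs_of_nonneg (softPotential_nonneg C x)]
        exact softPotential_le_coulomb (le_of_lt hC) x)
      (Eventually.of_forall tendsto_softPotential)
  -- The same limiting argument, now with C → 0⁺ along the undamped transforms.
  have hV₀F : IsGivenBy (𝓕 V₀) (fun ξ => 1 / (Real.pi * ‖ξ‖ ^ 2)) :=
    IsGivenBy.of_tendsto (l := 𝓝[>] (0 : ℝ)) (f := fun C => closedForm C 0)
      (eventually_mem_nhdsWithin.mono fun C hC => hVF C hC)
      (tendsto_fourier_distribution hVV₀)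
      (eventually_mem_nhdsWithin.mono fun C hC => measurable_closedForm hC le_rfl)
      (by fun_prop) integrable_schwartz_mul_fourier_coulomb
      (eventually_mem_nhdsWithin.mono fun C hC => ae_ne_zero_space3.mono fun ξ hξ =>
        abs_closedForm_le hC le_rfl hξ)
      (Eventually.of_forall fun ξ => (abs_of_nonneg (by positivity)).le)
      (ae_ne_zero_space3.mono fun ξ hξ => tendsto_closedForm_coulomb hξ)
  refine ⟨fun z hz => tendsto_besselKQuotient hz, fun C hC => not_integrable_softPotential hC,
    fun C hC => ⟨fun k hk => ⟨integrable_dampedPotential hC hk, fun ξ hξ =>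
      fourier_dampedPotential hC hk hξ⟩, fun ξ hξ => ?_⟩, fun ξ hξ => tendsto_closedForm_coulomb hξ,
    Vd, V, V₀, fun C hC k hk => hVd C k hC hk, hV, hV₀, hVdF, hVdV,
    fun C hC => tendsto_fourier_distribution (hVdV C hC), hVF, hVV₀,
    tendsto_fourier_distribution hVV₀, hV₀F⟩
  refine ((Complex.continuous_ofReal.tendsto _).comp (tendsto_closedForm_damping hC hξ)).congr' ?_
  filter_upwards [self_mem_nhdsWithin] with k hk
  exact (fourier_dampedPotential hC hk hξ).symm
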